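/- **Setting.** First-order standpoint logic (FOSL) has formulas $\phi,\psi ::= P(t_1,\dots,t_k)\mid\neg\phi\mid\phi\wedge\psi\mid\forall x\,\phi\mid\Box_e\phi$, where the terms $t_i$ are variables or constants and $e ::= *\mid s\mid e\cup e\mid e\cap e\mid e\setminus e$ with $s$ a standpoint symbol. A structure $\langle\Delta,\Pi,\sigma,\gamma\rangle$ consists of a non-empty domain $\Delta$, a non-empty set $\Pi$ of precisifications, a map $\sigma$ sending standpoint symbols to subsets of $\Pi$ (extended to expressions by $\sigma(*)=\Pi$ and the Boolean operations), and a map $\gamma$ sending each precisification to a first-order structure over $\Delta$, all with the same interpretation of constants. $\Box_e\phi$ holds at $\pi$ iff $\phi$ holds at all $\pi'\in\sigma(e)$; the other cases are evaluated in $\gamma(\pi)$. A formula is satisfiable iff in some structure it holds at all precisifications under all variable assignments. The size $|\phi|$ is the number of subformulas of $\phi$. A formula is sentential if no subformula $\Box_e\psi$ has free variables. $\mathrm{SSNF}(\phi)$ is the normal form of $\phi$ without nested modal operators: every modal subformula $\psi=\Box_e\chi$ in the scope of another modal operator is replaced by a fresh atom $L_\psi(\vec x)$, where $\vec x$ are the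 free variables of $\psi$, and for each such occurrence the conjunct $\forall\vec x\,(L_\psi(\vec x)\to\Box_e\chi^\circ)$ (positive occurrence) or $\forall\vec x\,(\Box_e\chi^\circ\to L_\psi(\vec x))$ (negative occurrence) is added, where $\chi^\circ$ is $\chi$ with its outermost modal subformulas replaced by their fresh atoms. The translation to first-order logic is $\mathrm{Trans}_n(\phi)=\bigwedge_{\pi<n}\mathrm{trans}_n(\pi,\phi)\wedge\bigwedge_{\pi<n} *_\pi$, where $\mathrm{trans}_n(\pi,\cdot)$ commutes with $\neg,\wedge,\forall$, maps $P(\vec t)$ to $P_\pi(\vec t)$, and maps $\Box_e\psi$ to $\bigwedge_{\pi'<n}(\mathrm{tr}(\pi',e)\to\mathrm{trans}_n(\pi',\psi))$. Here $\mathrm{tr}(\pi,s)=s_\pi$ and $\mathrm{tr}(\pi,*)=*_\pi$ are nullary predicates, and $\cup,\cap,\setminus$ become $\vee,\wedge,\wedge\neg$. For a set $\mathcal F$ of first-order formulas, $\mathbb S_{[\mathcal F]}$ is the set of sentential FOSL formulas $\phi$ without free variables such that $\psi\in\mathcal F$ whenever $\forall x\,\psi$ is a subformula of $\mathrm{SSNF}(\phi)$.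 $\mathcal F$ is standpoint-friendly if $\mathrm{Trans}_{|\phi|}(\mathrm{SSNF}(\phi))\in\mathcal F$ for every $\phi\in\mathbb S_{[\mathcal F]}$. The satisfiability problem for $\mathcal F$ is to decide, given a sentence of $\mathcal F$, whether it is satisfiable in first-order logic; for $\mathbb S_{[\mathcal F]}$ it is to decide, given $\phi\in\mathbb S_{[\mathcal F]}$, whether $\phi$ is satisfiable. (Membership of the input is promised.) **Lemma.** Let $\mathcal F$ be a standpoint-friendly set of first-order formulas such that, whenever $\forall x\,\psi$ is a subformula of a sentence in $\mathcal F$, also $\psi\in\mathcal F$ (for instance, a set that is closed under subformulas). Then: 1. Satisfiability for $\mathbb S_{[\mathcal F]}$ is decidable if and only if satisfiability for $\mathcal F$ is decidable. 2. If satisfiability for $\mathcal F$ is NP-hard (under polynomial-time many-one reductions), then satisfiability for $\mathbb S_{[\mathcal F]}$ has the same complexity as satisfiability for $\mathcal F$: the two problems are polynomial-time many-one reducible to each other. -/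

import Mathlib

namespace FOSL

/-! ## Formulas -/

/-- Names are words over `{0,1}`. -/
abbrev Ident := List Bool

/-- Names of predicate symbols. A predicate symbol is a pair of a name and an arity; the arity is
given by the number of arguments in an atom. The names are closed under forming the copies `P_π`
and the names `s_π`, `*_π` (here `stand (some s) π` and `stand none π`) of the translation, where
precisifications are numbered by natural numbers. -/
inductive PredName where
  | base (w : Ident)
  | copy (P : PredName) (i : ℕ)
  | stand (s : Option Ident) (i : ℕ)
  deriving DecidableEq

inductive Term where
  | var (x : Ident)
  | const (a : Ident)
  deriving DecidableEq

/-- Standpoint expressions; `all` is `*`. -/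
inductive StExpr where
  | all
  | symb (s : Ident)
  | union (e₁ e₂ : StExpr)
  | inter (e₁ e₂ : StExpr)
  | diff (e₁ e₂ : StExpr)
  deriving DecidableEq

/-- Formulas of first-order standpoint logic. -/
inductive Formula where
  | atom (P : PredName) (ts : List Term)
  | neg (φ : Formula)
  | and (φ ψ : Formula)
  | all (x : Ident) (φ : Formula)
  | box (e : StExpr) (φ : Formula)
  deriving DecidableEq

/-- Formulas of plain first-order logic. -/
inductive FOFormula where
  | atom (P : PredName) (ts : List Term)
  | neg (φ : FOFormula)
  | and (φ ψ : FOFormula)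
  | all (x : Ident) (φ : FOFormula)
  deriving DecidableEq

/-- First-order formulas are formulas of standpoint logic. -/
def FOFormula.toFormula : FOFormula → Formula
  | atom P ts => .atom P ts
  | neg φ => .neg φ.toFormula
  | and φ ψ => .and φ.toFormula ψ.toFormula
  | all x φ => .all x φ.toFormula

def Formula.imp (φ ψ : Formula) : Formula := .neg (.and φ (.neg ψ))

def FOFormula.imp (φ ψ : FOFormula) : FOFormula := .neg (.and φ (.neg ψ))

def FOFormula.or (φ ψ : FOFormula) : FOFormula := .neg (.and (.neg φ) (.neg ψ))

/-- The finite set of subformulas, including the formula itself. -/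
def Formula.sub : Formula → Finset Formula
  | atom P ts => {atom P ts}
  | neg φ => insert (neg φ) φ.sub
  | and φ ψ => insert (and φ ψ) (φ.sub ∪ ψ.sub)
  | all x φ => insert (all x φ) φ.sub
  | box e φ => insert (box e φ) φ.sub

/-- The size of a formula: its number of subformulas. -/
def Formula.size (φ : Formula) : ℕ := φ.sub.card

def Term.vars : Term → List Ident
  | var x => [x]
  | const _ => []

/-- The free variables, listed without repetition. -/
def Formula.freeVars : Formula → List Ident
  | atom _ ts => (ts.flatMap Term.vars).dedup
  | neg φ => φ.freeVars
  | and φ ψ => φ.freeVars ∪ ψ.freeVars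
  | all x φ => φ.freeVars.filter (fun y => y ≠ x)
  | box _ φ => φ.freeVars

/-- A formula is closed (a sentence) if it has no free variables. -/
def Formula.Closed (φ : Formula) : Prop := φ.freeVars = []

def FOFormula.Closed (φ : FOFormula) : Prop := φ.toFormula.Closed

/-- No free variables below a modal operator. -/
def Formula.Sentential (φ : Formula) : Prop :=
  ∀ e ψ, Formula.box e ψ ∈ φ.sub → ψ.Closed

/-! ## Semantics -/

/-- First-order structures over the domain `Δ`; the predicate symbol with name `P` and arity `k`
is interpreted by the restriction of `rel P` to lists of length `k`. -/
structure FOStructure (Δ : Type) where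
  rel : PredName → List Δ → Prop
  const : Ident → Δ

def Term.eval {Δ : Type} (I : FOStructure Δ) (v : Ident → Δ) : Term → Δ
  | var x => v x
  | const a => I.const a

def FOFormula.Holds {Δ : Type} (I : FOStructure Δ) : (Ident → Δ) → FOFormula → Prop
  | v, atom P ts => I.rel P (ts.map (Term.eval I v))
  | v, neg φ => ¬ FOFormula.Holds I v φ
  | v, and φ ψ => FOFormula.Holds I v φ ∧ FOFormula.Holds I v ψ
  | v, all x φ => ∀ d : Δ, FOFormula.Holds I (Function.update v x d) φ

/-- Satisfiability in plain first-order logic. -/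
def FOFormula.Satisfiable (φ : FOFormula) : Prop :=
  ∃ (Δ : Type) (_ : Nonempty Δ) (I : FOStructure Δ), ∀ v, φ.Holds I v

/-- First-order standpoint structures, with constant domain and rigid constants. -/
structure StandpointStructure where
  Δ : Type
  Prec : Type
  nonempty_domain : Nonempty Δ
  nonempty_prec : Nonempty Prec
  σ : Ident → Set Prec
  γ : Prec → FOStructure Δ
  rigid : ∀ p q a, (γ p).const a = (γ q).const a

def StExpr.eval (M : StandpointStructure) : StExpr → Set M.Prec
  | all => Set.univ
  | symb s => M.σ s
  | union e₁ e₂ => e₁.eval M ∪ e₂.eval M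
  | inter e₁ e₂ => e₁.eval M ∩ e₂.eval M
  | diff e₁ e₂ => e₁.eval M \ e₂.eval M

def Formula.Holds (M : StandpointStructure) : M.Prec → (Ident → M.Δ) → Formula → Prop
  | p, v, atom P ts => (M.γ p).rel P (ts.map (Term.eval (M.γ p) v))
  | p, v, neg φ => ¬ Formula.Holds M p v φ
  | p, v, and φ ψ => Formula.Holds M p v φ ∧ Formula.Holds M p v ψ
  | p, v, all x φ => ∀ d : M.Δ, Formula.Holds M p (Function.update v x d) φ
  | _, v, box e φ => ∀ q ∈ e.eval M, Formula.Holds M q v φ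

/-- Satisfiability in first-order standpoint logic: truth at all precisifications. -/
def Formula.Satisfiable (φ : Formula) : Prop :=
  ∃ M : StandpointStructure, ∀ p v, φ.Holds M p v

/-! ## Syntax trees as data -/

/-- Binary trees, the data on which programs operate. -/
inductive Data where
  | nil
  | cons (a b : Data)
  deriving DecidableEq

def Data.size : Data → ℕ
  | nil => 1
  | cons a b => a.size + b.size + 1

/-- The Gödel number of a tree (a bijection onto `ℕ`). -/
def Data.toNat : Data → ℕ
  | nil => 0
  | cons a b => Nat.pair a.toNat b.toNat + 1

def Data.ofList : List Data → Data
  | [] => .nil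
  | d :: l => .cons d (Data.ofList l)

def Data.unary (n : ℕ) : Data := Data.ofList (List.replicate n .nil)

def Data.word (w : Ident) : Data :=
  Data.ofList (w.map fun b => if b then .cons .nil .nil else .nil)

def Data.tag (n : ℕ) (d : Data) : Data := .cons (Data.unary n) d

def PredName.code : PredName → Data
  | base w => .tag 0 (.word w)
  | copy P i => .tag 1 (.cons P.code (.unary i))
  | stand none i => .tag 2 (.unary i)
  | stand (some s) i => .tag 3 (.cons (.word s) (.unary i))

def Term.code : Term → Data
  | var x => .tag 0 (.word x)
  | const a => .tag 1 (.word a)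

def StExpr.code : StExpr → Data
  | all => .tag 0 .nil
  | symb s => .tag 1 (.word s)
  | union e₁ e₂ => .tag 2 (.cons e₁.code e₂.code)
  | inter e₁ e₂ => .tag 3 (.cons e₁.code e₂.code)
  | diff e₁ e₂ => .tag 4 (.cons e₁.code e₂.code)

/-- The syntax tree of a formula. Its size is, up to a constant factor, the length of the formula
written as a word. -/
def Formula.code : Formula → Data
  | atom P ts => .tag 0 (.cons P.code (.ofList (ts.map Term.code)))
  | neg φ => .tag 1 φ.code
  | and φ ψ => .tag 2 (.cons φ.code ψ.code)
  | all x φ => .tag 3 (.cons (.word x) φ.code)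
  | box e φ => .tag 4 (.cons e.code φ.code)

def FOFormula.code (φ : FOFormula) : Data := φ.toFormula.code

/-! ## Standpoint standard normal form -/

/-- The occurrences of modal subformulas. -/
def Formula.boxes : Formula → List Formula
  | atom _ _ => []
  | neg φ => φ.boxes
  | and φ ψ => φ.boxes ++ ψ.boxes
  | all _ φ => φ.boxes
  | box e φ => box e φ :: φ.boxes

/-- The fresh atom `L_ψ(x₁,…,xₘ)` for the modal subformula `ψ` of `φ`, where `x₁,…,xₘ` are the free
variables of `ψ`. Its name is a word that is longer than every name in `φ`, and different `ψ` get
names of different length. -/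
def Formula.label (φ ψ : Formula) : Formula :=
  .atom (.base (List.replicate (φ.code.size + φ.boxes.idxOf ψ) true)) (ψ.freeVars.map Term.var)

/-- Replace the outermost modal subformulas `ψ` by `L_ψ`. -/
def Formula.flatten (φ : Formula) : Formula → Formula
  | atom P ts => atom P ts
  | neg ψ => neg (Formula.flatten φ ψ)
  | and ψ χ => and (Formula.flatten φ ψ) (Formula.flatten φ χ)
  | all x ψ => all x (Formula.flatten φ ψ)
  | box e ψ => φ.label (box e ψ)

/-- Replace the modal subformulas `ψ` of modal depth two (that is, the outermost ones in the scope
of another modal operator) by `L_ψ`. -/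
def Formula.flattenNested (φ : Formula) : Formula → Formula
  | atom P ts => atom P ts
  | neg ψ => neg (Formula.flattenNested φ ψ)
  | and ψ χ => and (Formula.flattenNested φ ψ) (Formula.flattenNested φ χ)
  | all x ψ => all x (Formula.flattenNested φ ψ)
  | box e ψ => box e (Formula.flatten φ ψ)

/-- The universal quantification over the variables in a list. -/
def Formula.alls (l : List Ident) (φ : Formula) : Formula := l.foldr Formula.all φ

/-- The definitions of the fresh atoms: for every modal subformula `ψ = □ₑχ` in the scope of another
modal operator, `∀x₁…xₘ (L_ψ → □ₑχ°)` for a positive and `∀x₁…xₘ (□ₑχ° → L_ψ)` for a negative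
occurrence, where `χ°` is `χ` with its modal subformulas replaced by their fresh atoms. The first
argument `pos` is the polarity of the current occurrence, and `nested` says whether it is in the
scope of a modal operator. -/
def Formula.definitions (φ : Formula) : (pos nested : Bool) → Formula → List Formula
  | _, _, atom _ _ => []
  | pos, nested, neg ψ => Formula.definitions φ (!pos) nested ψ
  | pos, nested, and ψ χ =>
      Formula.definitions φ pos nested ψ ++ Formula.definitions φ pos nested χ
  | pos, nested, all _ ψ => Formula.definitions φ pos nested ψ
  | pos, nested, box e ψ =>
      (if nested then
        [Formula.alls ψ.freeVars
          (if pos then (φ.label (box e ψ)).imp (box e (Formula.flatten φ ψ))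
            else (box e (Formula.flatten φ ψ)).imp (φ.label (box e ψ)))]
      else []) ++ Formula.definitions φ pos true ψ

/-- The standpoint standard normal form: no modal operator is in the scope of another one. A formula
that already has this property is left unchanged. -/
def Formula.ssnf (φ : Formula) : Formula :=
  (φ.definitions true false φ).foldl Formula.and (φ.flattenNested φ)

/-! ## Translation to first-order logic -/

/-- A finite conjunction; the empty one is a tautology. -/
def FOFormula.conj : List FOFormula → FOFormula
  | [] => .neg (.and (.atom (.stand none 0) []) (.neg (.atom (.stand none 0) [])))
  | [φ] => φ
  | φ :: ψ :: l => .and φ (FOFormula.conj (ψ :: l))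

def StExpr.trans (i : ℕ) : StExpr → FOFormula
  | all => .atom (.stand none i) []
  | symb s => .atom (.stand (some s) i) []
  | union e₁ e₂ => .or (e₁.trans i) (e₂.trans i)
  | inter e₁ e₂ => .and (e₁.trans i) (e₂.trans i)
  | diff e₁ e₂ => .and (e₁.trans i) (.neg (e₂.trans i))

/-- The translation at the precisification `i`, for the precisifications `0, …, n - 1`. -/
def Formula.transAt (n : ℕ) : ℕ → Formula → FOFormula
  | i, atom P ts => .atom (.copy P i) ts
  | i, neg φ => .neg (Formula.transAt n i φ)
  | i, and φ ψ => .and (Formula.transAt n i φ) (Formula.transAt n i ψ)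
  | i, all x φ => .all x (Formula.transAt n i φ)
  | _, box e φ =>
      .conj ((List.range n).map fun j => (e.trans j).imp (Formula.transAt n j φ))

/-- The translation `Trans_n`. -/
def Formula.trans (n : ℕ) (φ : Formula) : FOFormula :=
  .and (.conj ((List.range n).map fun i => φ.transAt n i))
    (.conj ((List.range n).map fun i => .atom (.stand none i) []))

/-! ## Fragments -/

/-- The set `S_[F]` of formulas of sentential Standpoint-`F`. -/
def SententialStandpoint (F : Set FOFormula) : Set Formula :=
  {φ | φ.Sentential ∧ φ.Closed ∧
    ∀ x ψ, Formula.all x ψ ∈ φ.ssnf.sub → ∃ χ ∈ F, χ.toFormula = ψ}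

def StandpointFriendly (F : Set FOFormula) : Prop :=
  ∀ φ ∈ SententialStandpoint F, φ.ssnf.trans φ.size ∈ F

/-- With a sentence, `F` contains the scope of every quantifier in it. Every set of formulas that is
closed under subformulas has this property. -/
def ClosedUnderScopes (F : Set FOFormula) : Prop :=
  ∀ φ ∈ F, φ.Closed →
    ∀ x ψ, (FOFormula.all x ψ).toFormula ∈ φ.toFormula.sub → ψ ∈ F

/-! ## Programs and running time -/

/-- Programs computing partial functions on trees: identity, the constant `nil`, the two components
of a tree, pairing of two results, composition (`comp p q` runs `p` first), case distinction on
whether the result of `c` is `nil`, and `while` loops. -/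
inductive Prog where
  | id
  | nil
  | fst
  | snd
  | pair (p q : Prog)
  | comp (p q : Prog)
  | ite (c p q : Prog)
  | while (c p : Prog)

def Data.fst : Data → Data
  | nil => nil
  | cons a _ => a

def Data.snd : Data → Data
  | nil => nil
  | cons _ b => b

/-- `Run p x y t`: on input `x`, the program `p` halts with output `y` in time `t`. All elementary
steps are charged with the size of the trees that they read and write, so that this time is
polynomially related to the running time of Turing machines. -/
inductive Run : Prog → Data → Data → ℕ → Prop where
  | id (x) : Run .id x x (x.size + x.size)
  | nil (x) : Run .nil x .nil (x.size + 1)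
  | fst (x) : Run .fst x x.fst (x.size + x.fst.size)
  | snd (x) : Run .snd x x.snd (x.size + x.snd.size)
  | pair {p q x y z s t} : Run p x y s → Run q x z t →
      Run (.pair p q) x (.cons y z) (s + t + x.size + (Data.cons y z).size)
  | comp {p q x y z s t} : Run p x y s → Run q y z t → Run (.comp p q) x z (s + t + 1)
  | ite_then {c p q x a b y s t} : Run c x (.cons a b) s → Run p x y t →
      Run (.ite c p q) x y (s + t + x.size + 1)
  | ite_else {c p q x y s t} : Run c x .nil s → Run q x y t →
      Run (.ite c p q) x y (s + t + x.size + 1)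
  | while_done {c p x s} : Run c x .nil s → Run (.while c p) x x (s + x.size + 1)
  | while_step {c p x a b y z s t u} : Run c x (.cons a b) s → Run p x y t →
      Run (.while c p) y z u → Run (.while c p) x z (s + t + u + x.size + 1)

/-! ## Decision problems -/

/-- A decision problem: instances, their encoding, and the set of positive instances. Algorithms
are only ever run on (encodings of) instances. -/
structure Problem where
  Inst : Type
  code : Inst → Data
  Yes : Inst → Prop

/-- Some partial recursive function answers correctly, and hence is defined, on all instances. -/
def Problem.IsDecidable (A : Problem) : Prop :=
  ∃ f : ℕ →. Bool, Partrec f ∧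
    ∀ i : A.Inst, ∃ b ∈ f (A.code i).toNat, (b = true ↔ A.Yes i)

/-- Polynomial-time many-one reducibility. -/
def Problem.Reduces (A B : Problem) : Prop :=
  ∃ (p : Prog) (r : Polynomial ℕ), ∀ i : A.Inst, ∃ (j : B.Inst) (t : ℕ),
    Run p (A.code i) (B.code j) t ∧ t ≤ r.eval (A.code i).size ∧ (A.Yes i ↔ B.Yes j)

/-- The same complexity: reducibility to each other in polynomial time. -/
def Problem.SameComplexity (A B : Problem) : Prop := A.Reduces B ∧ B.Reduces A

/-- The membership problem of a set of trees. -/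
def Problem.ofSet (L : Set Data) : Problem where
  Inst := Data
  code := fun x => x
  Yes := fun x => x ∈ L

/-- The class NP: polynomial-time verification of certificates of polynomial size. -/
def InNP (L : Set Data) : Prop :=
  ∃ (p : Prog) (r : Polynomial ℕ),
    (∀ x w, ∃ y t, Run p (.cons x w) y t ∧ t ≤ r.eval (Data.cons x w).size) ∧
    ∀ x, x ∈ L ↔ ∃ w, w.size ≤ r.eval x.size ∧ ∃ y t, Run p (.cons x w) y t ∧ y ≠ .nil

def Problem.NPHard (A : Problem) : Prop :=
  ∀ L : Set Data, InNP L → (Problem.ofSet L).Reduces A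

/-- The satisfiability problem of a set of first-order formulas: the instances are its sentences. -/
def satFO (F : Set FOFormula) : Problem where
  Inst := {φ : FOFormula // φ ∈ F ∧ φ.Closed}
  code := fun φ => φ.1.code
  Yes := fun φ => φ.1.Satisfiable

/-- The satisfiability problem of sentential Standpoint-`F`. -/
def satStandpoint (F : Set FOFormula) : Problem where
  Inst := {φ : Formula // φ ∈ SententialStandpoint F}
  code := fun φ => φ.1.code
  Yes := fun φ => φ.1.Satisfiable

end FOSL

namespace FOSL

/-! The two satisfiability problems are reducible to each other by polynomial-time many-one
reductions, and both claims follow from that. For decidability one also needs that programs compute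
partial recursive functions on Gödel numbers (`exists_partrec`).

From first-order logic to standpoint logic the identity is a reduction (`satFO_reduces`). A
first-order sentence has no modal operators and is its own normal form, so closure under scopes
places it in the standpoint fragment; a first-order model is a standpoint model with one
precisification.

In the other direction φ is sent to Trans_{|φ|}(SSNF(φ)), which is in `F` by friendliness and is a
sentence by `Formula.closed_trans`. Correctness is `Formula.satisfiable_trans_ssnf_iff`. Since φ is
sentential, the truth value of a modal subformula depends neither on the precisification nor on the
assignment. Hence one counterexample for each false modal subformula suffices, which gives a model
with |φ| precisifications (`Formula.Satisfiable.exists_small`); and every model expands to one of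
the normal form by making a label true exactly when its modal formula is
(`Formula.holds_ssnf_expand`). Conversely, by induction with polarities, every model of the normal
form is a model of φ (`Formula.holds_of_ssnf`). A standpoint model with n precisifications amounts
to one first-order structure with n copies of each predicate (`Describes.trans`).

The running time is the content of `exists_pt_trans_ssnf`. Each modal operator multiplies the length
of its scope by n in the translation, but operators are not nested in the normal form. The programs
are assembled from closure properties of `PT`, above all recursion on trees (`TreeView.pt_rec`): it
stays polynomial as long as the value at a tree is at most the sum of the sizes of the values at its
children plus a polynomial in the input. -/

/-! ## Typed polynomial-time computability -/

/-- Types whose elements are represented by trees. -/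
class Enc (α : Type) where
  enc : α → Data

open Enc (enc)

/-- The size of the representation. -/
def sz {α : Type} [Enc α] (a : α) : ℕ := (enc a).size

instance : Enc Data := ⟨fun d => d⟩
instance : Enc Bool := ⟨fun b => if b then .cons .nil .nil else .nil⟩
instance : Enc ℕ := ⟨Data.unary⟩
instance {α : Type} [Enc α] : Enc (List α) := ⟨fun l => Data.ofList (l.map enc)⟩
instance {α β : Type} [Enc α] [Enc β] : Enc (α × β) := ⟨fun p => .cons (enc p.1) (enc p.2)⟩
instance : Enc PredName := ⟨PredName.code⟩
instance : Enc Term := ⟨Term.code⟩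
instance : Enc StExpr := ⟨StExpr.code⟩
instance : Enc Formula := ⟨Formula.code⟩
instance : Enc FOFormula := ⟨FOFormula.code⟩

/-- The traversal is defined with fuel. The weight of a tree is positive and exceeds that of each
child, so fuel `m x` is enough, any larger amount gives the same list, and the fallback at fuel zero
is never reached. -/
theorem exists_preorder {α : Type} {kids : α → List α} {m : α → ℕ}
    (h : ∀ x, ((kids x).map m).sum < m x) :
    ∃ pre : α → List α, ∀ x, pre x = x :: (kids x).flatMap pre := by
  let aux : ℕ → α → List α := Nat.rec (fun x => [x]) (fun _ ih x => x :: (kids x).flatMap ih)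
  have aux_succ : ∀ n x, aux (n + 1) x = x :: (kids x).flatMap (aux n) := fun _ _ => rfl
  have hm : ∀ x, ∀ y ∈ kids x, m y < m x := fun x y hy =>
    (List.single_le_sum (by simp) _ (List.mem_map_of_mem hy)).trans_lt (h x)
  have aux_eq : ∀ n k x, m x ≤ n → m x ≤ k → aux n x = aux k x := by
    intro n
    induction n with
    | zero => intro k x h1; have := h x; omega
    | succ n ih =>
      intro k x h1 h2
      cases k with
      | zero => have := h x; omega
      | succ k =>
        rw [aux_succ, aux_succ]
        congr 1
        exact List.flatMap_congr fun y hy => ih k y (by have := hm x y hy; omega)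
          (by have := hm x y hy; omega)
  refine ⟨fun x => aux (m x) x, fun x => ?_⟩
  beta_reduce
  rw [← aux_eq (m x + 1) (m x) x (by omega) le_rfl, aux_succ]
  congr 1
  exact List.flatMap_congr fun y hy => aux_eq _ _ y (hm x y hy).le le_rfl

section
variable {α β γ δ : Type} [Enc α] [Enc β] [Enc γ] [Enc δ]

/-! ### Encodings and their sizes. -/

@[simp] theorem enc_data (d : Data) : enc d = d := rfl
@[simp] theorem enc_list_nil : enc ([] : List α) = .nil := rfl
@[simp] theorem enc_list_cons (a : α) (l : List α) : enc (a :: l) = .cons (enc a) (enc l) := rfl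
@[simp] theorem enc_prod (a : α) (b : β) : enc (a, b) = .cons (enc a) (enc b) := rfl
@[simp] theorem enc_zero : enc (0 : ℕ) = .nil := rfl
@[simp] theorem enc_succ (n : ℕ) : enc (n + 1) = .cons .nil (enc n) := rfl
@[simp] theorem enc_true : enc true = .cons .nil .nil := rfl
@[simp] theorem enc_false : enc false = .nil := rfl

@[simp] theorem sz_nil_data : sz Data.nil = 1 := rfl
@[simp] theorem sz_cons_data (a b : Data) : sz (Data.cons a b) = sz a + sz b + 1 := rfl
@[simp] theorem sz_list_nil : sz ([] : List α) = 1 := rfl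
@[simp] theorem sz_list_cons (a : α) (l : List α) : sz (a :: l) = sz a + sz l + 1 := rfl
@[simp] theorem sz_prod (a : α) (b : β) : sz (a, b) = sz a + sz b + 1 := rfl
@[simp] theorem sz_zero : sz (0 : ℕ) = 1 := rfl
@[simp] theorem sz_succ (n : ℕ) : sz (n + 1) = sz n + 2 := by
  simp only [sz, enc_succ, Data.size]; omega
@[simp] theorem sz_true : sz true = 3 := rfl
@[simp] theorem sz_false : sz false = 1 := rfl
theorem sz_bool_le (b : Bool) : sz b ≤ 3 := by cases b <;> simp

theorem Data.size_pos (d : Data) : 0 < d.size := by cases d <;> simp [Data.size]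

theorem sz_pos (a : α) : 0 < sz a := Data.size_pos _

theorem sz_list_le {l : List α} {B : ℕ} (h : ∀ a ∈ l, sz a ≤ B) :
    sz l ≤ l.length * (B + 1) + 1 := by
  induction l with
  | nil => simp
  | cons a l ih =>
    have h1 := h a (by simp)
    have h2 := ih fun b hb => h b (by simp [hb])
    simp only [sz_list_cons, List.length_cons]
    nlinarith

theorem length_le_sz (l : List α) : l.length ≤ sz l := by
  induction l with
  | nil => simp
  | cons a l ih => simp; omega

theorem eval_mono (r : Polynomial ℕ) {m n : ℕ} (h : m ≤ n) : r.eval m ≤ r.eval n := by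
  rw [Polynomial.eval_eq_sum_range, Polynomial.eval_eq_sum_range]
  gcongr

/-- Every step is charged with the size of what it writes. Polynomial time therefore bounds the
output polynomially, which is what composition needs. -/
theorem Run.size_le {p : Prog} {x y : Data} {t : ℕ} (h : Run p x y t) : y.size ≤ t := by
  induction h <;> (try simp only [Data.size] at *) <;> omega

/-- `f` is computed in polynomial time on the representations of the elements of `S`. -/
def PTOn (S : Set α) (f : α → β) : Prop :=
  ∃ (p : Prog) (r : Polynomial ℕ), ∀ a ∈ S, ∃ t,
    Run p (enc a) (enc (f a)) t ∧ t ≤ r.eval (sz a)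

/-- `f` is computable in polynomial time. -/
@[fun_prop]
def PT (f : α → β) : Prop :=
  ∃ (p : Prog) (r : Polynomial ℕ), ∀ a, ∃ t, Run p (enc a) (enc (f a)) t ∧ t ≤ r.eval (sz a)

theorem PT.sz_le {f : α → β} (h : PT f) : ∃ q : Polynomial ℕ, ∀ a, sz (f a) ≤ q.eval (sz a) := by
  obtain ⟨p, r, h⟩ := h
  refine ⟨r, fun a => ?_⟩
  obtain ⟨t, h1, h2⟩ := h a
  exact h1.size_le.trans h2

/-- Only the representations matter: the program for `g` serves unchanged for `f`. -/
theorem PT.of_enc_comp {f : α → β} {g : γ → δ} {v : α → γ} (h : PT g)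
    (hv : ∀ a, enc (v a) = enc a) (hf : ∀ a, enc (f a) = enc (g (v a))) : PT f := by
  obtain ⟨p, r, h⟩ := h
  refine ⟨p, r, fun a => ?_⟩
  obtain ⟨t, h1, h2⟩ := h (v a)
  rw [hf, ← hv]
  refine ⟨t, h1, h2.trans_eq ?_⟩
  rw [sz, hv, sz]

/-! ### Closure under composition, pairing and projections. -/

@[fun_prop]
theorem PT.id : PT (fun a : α => a) :=
  ⟨.id, 2 * .X, fun a => ⟨_, .id _, by simp [sz]; omega⟩⟩

@[fun_prop]
theorem PT.comp {g : β → γ} {f : α → β} (hg : PT g) (hf : PT f) : PT (fun a => g (f a)) := by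
  obtain ⟨p, r, hp⟩ := hf
  obtain ⟨p', r', hp'⟩ := hg
  refine ⟨.comp p p', r + r'.comp r + 1, fun a => ?_⟩
  obtain ⟨t, h1, h2⟩ := hp a
  obtain ⟨t', h1', h2'⟩ := hp' (f a)
  refine ⟨_, .comp h1 h1', ?_⟩
  have : r'.eval (sz (f a)) ≤ r'.eval (r.eval (sz a)) := eval_mono _ (h1.size_le.trans h2)
  simp only [Polynomial.eval_add, Polynomial.eval_comp, Polynomial.eval_one]
  omega

theorem PT.data_cons {f g : α → Data} (hf : PT f) (hg : PT g) :
    PT (fun a => Data.cons (f a) (g a)) := by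
  obtain ⟨p, r, hp⟩ := hf
  obtain ⟨p', r', hp'⟩ := hg
  refine ⟨.pair p p', r + r' + .X + r + r' + 1, fun a => ?_⟩
  obtain ⟨t, h1, h2⟩ := hp a
  obtain ⟨t', h1', h2'⟩ := hp' a
  refine ⟨_, .pair h1 h1', ?_⟩
  have := h1.size_le
  have := h1'.size_le
  simp only [Polynomial.eval_add, Polynomial.eval_one, Polynomial.eval_X, Data.size, sz,
    enc_data] at *
  omega

theorem PT.data_nil : PT (fun _ : α => Data.nil) :=
  ⟨.nil, .X + 1, fun a => ⟨_, .nil _, by simp [sz]⟩⟩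

/-- The only primitive constant is `nil`; any other fixed tree is built by pairing. -/
theorem PT.enc_const (d : Data) : PT (fun _ : α => d) := by
  induction d with
  | nil => exact .data_nil
  | cons a b iha ihb => exact .data_cons iha ihb

@[fun_prop]
theorem PT.const (b : β) : PT (fun _ : α => b) :=
  PT.of_enc_comp (v := fun a => a) (.enc_const (enc b)) (fun _ => rfl) (fun _ => rfl)

theorem PT.of_enc {f : α → β} (h : PT (fun a => enc (f a))) : PT f :=
  PT.of_enc_comp (v := fun a => a) h (fun _ => rfl) (fun _ => rfl)

theorem PT.to_enc {f : α → β} (h : PT f) : PT (fun a => enc (f a)) :=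
  PT.of_enc_comp (v := fun a => a) h (fun _ => rfl) (fun _ => rfl)

theorem PT.data_fst {f : α → Data} (hf : PT f) : PT (fun a => (f a).fst) := by
  refine PT.comp (g := Data.fst) ⟨.fst, 2 * .X, fun a => ⟨_, .fst _, ?_⟩⟩ hf
  cases a <;> simp [sz, Data.fst, Data.size]; omega

theorem PT.data_snd {f : α → Data} (hf : PT f) : PT (fun a => (f a).snd) := by
  refine PT.comp (g := Data.snd) ⟨.snd, 2 * .X, fun a => ⟨_, .snd _, ?_⟩⟩ hf
  cases a <;> simp [sz, Data.snd, Data.size]; omega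

@[fun_prop]
theorem PT.prod_mk {f : α → β} {g : α → γ} (hf : PT f) (hg : PT g) : PT (fun a => (f a, g a)) :=
  .of_enc (.data_cons hf.to_enc hg.to_enc)

@[fun_prop]
theorem PT.fst {f : α → β × γ} (hf : PT f) : PT (fun a => (f a).1) :=
  .of_enc (.data_fst hf.to_enc)

@[fun_prop]
theorem PT.snd {f : α → β × γ} (hf : PT f) : PT (fun a => (f a).2) :=
  .of_enc (.data_snd hf.to_enc)

@[fun_prop]
theorem PT.list_cons {f : α → β} {g : α → List β} (hf : PT f) (hg : PT g) :
    PT (fun a => f a :: g a) :=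
  .of_enc (.data_cons hf.to_enc hg.to_enc)

@[fun_prop]
theorem PT.succ {f : α → ℕ} (hf : PT f) : PT (fun a => f a + 1) :=
  .of_enc (.data_cons .data_nil hf.to_enc)

/-! ### Case distinctions. -/

theorem ptOn_univ {f : α → β} : PTOn Set.univ f ↔ PT f := by simp [PTOn, PT]

theorem PTOn.mono {S T : Set α} {f : α → β} (h : PTOn T f) (hST : S ⊆ T) : PTOn S f := by
  obtain ⟨p, r, h⟩ := h
  exact ⟨p, r, fun a ha => h a (hST ha)⟩

/-- Each branch needs a program that is correct on its own part of the inputs only, which is why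
time bounds relative to a set are used here. -/
theorem PTOn.branch {S : Set α} {T : Data → Data} {f : α → β} (hT : PT T)
    (h0 : PTOn (S ∩ {a | T (enc a) = .nil}) f) (h1 : PTOn (S ∩ {a | T (enc a) ≠ .nil}) f) :
    PTOn S f := by
  obtain ⟨p, r, hp⟩ := h0
  obtain ⟨p', r', hp'⟩ := h1
  obtain ⟨c, rc, hc⟩ := hT
  refine ⟨.ite c p' p, rc + r + r' + .X + 1, fun a ha => ?_⟩
  obtain ⟨s, hs, hs'⟩ := hc (enc a)
  simp only [Polynomial.eval_add, Polynomial.eval_one, Polynomial.eval_X]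
  rw [enc_data, enc_data] at hs
  change s ≤ rc.eval (sz a) at hs'
  by_cases h : T (enc a) = .nil
  · obtain ⟨t, ht, ht'⟩ := hp a ⟨ha, h⟩
    rw [h] at hs
    refine ⟨_, .ite_else hs ht, ?_⟩
    simp only [sz] at *
    omega
  · obtain ⟨t, ht, ht'⟩ := hp' a ⟨ha, h⟩
    obtain ⟨u, v, huv⟩ : ∃ u v, T (enc a) = .cons u v := by
      cases hd : T (enc a) with
      | nil => exact absurd hd h
      | cons u v => exact ⟨u, v, rfl⟩
    rw [huv] at hs
    refine ⟨_, .ite_then hs ht, ?_⟩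
    simp only [sz] at *
    omega

/-- A branch of a case distinction: on `S`, the function `f` is `g` after the data
transformation `V`. -/
theorem PTOn.of_view {S : Set α} {f : α → β} {V : Data → Data} {g : γ → β} (hV : PT V) (hg : PT g)
    (h : ∀ a ∈ S, ∃ c, V (enc a) = enc c ∧ f a = g c) : PTOn S f := by
  obtain ⟨p, r, hp⟩ := hV
  obtain ⟨p', r', hp'⟩ := hg
  refine ⟨.comp p p', r + r'.comp r + 1, fun a ha => ?_⟩
  obtain ⟨c, hc, hf⟩ := h a ha
  obtain ⟨t, h1, h2⟩ := hp (enc a)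
  obtain ⟨t', h1', h2'⟩ := hp' c
  rw [enc_data, enc_data, hc] at h1
  rw [← hf] at h1'
  refine ⟨_, .comp h1 h1', ?_⟩
  change t ≤ r.eval (sz a) at h2
  have : r'.eval (sz c) ≤ r'.eval (r.eval (sz a)) := eval_mono _ (h1.size_le.trans h2)
  simp only [Polynomial.eval_add, Polynomial.eval_comp, Polynomial.eval_one]
  omega

@[fun_prop]
theorem PT.cond {c : α → Bool} {f g : α → β} (hc : PT c) (hf : PT f) (hg : PT g) :
    PT (fun a => bif c a then f a else g a) := by
  have key : PT (fun p : Bool × α => bif p.1 then f p.2 else g p.2) := by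
    refine ptOn_univ.1 (PTOn.branch (T := fun d => d.fst) (.data_fst .id) ?_ ?_)
    · refine PTOn.of_view (V := fun d => d.snd) (.data_snd .id) hg ?_
      rintro ⟨b, a⟩ ⟨-, h⟩
      cases b
      · exact ⟨a, rfl, rfl⟩
      · simp [Data.fst] at h
    · refine PTOn.of_view (V := fun d => d.snd) (.data_snd .id) hf ?_
      rintro ⟨b, a⟩ ⟨-, h⟩
      cases b
      · simp [Data.fst] at h
      · exact ⟨a, rfl, rfl⟩
  exact PT.comp key (.prod_mk hc .id)

/-- The list `a :: l` and the pair `(a, l)` are represented by the same tree, so the second branch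
needs no conversion; the first only has to forget the empty list. -/
theorem PT.list_cases {f : γ → List α → β} (h0 : PT (fun c => f c []))
    (h1 : PT (fun p : γ × α × List α => f p.1 (p.2.1 :: p.2.2))) :
    PT (fun p : γ × List α => f p.1 p.2) := by
  refine ptOn_univ.1 (PTOn.branch (T := fun d => d.snd) (.data_snd .id) ?_ ?_)
  · refine PTOn.of_view (V := fun d => d.fst) (.data_fst .id) h0 ?_
    rintro ⟨c, _ | ⟨a, l⟩⟩ ⟨-, h⟩
    · exact ⟨c, rfl, rfl⟩
    · simp [Data.snd] at h
  · refine PTOn.of_view (V := fun d => d) .id h1 ?_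
    rintro ⟨c, _ | ⟨a, l⟩⟩ ⟨-, h⟩
    · simp [Data.snd] at h
    · exact ⟨(c, a, l), rfl, rfl⟩

theorem PT.nat_cases {f : γ → ℕ → β} (h0 : PT (fun c => f c 0))
    (h1 : PT (fun p : γ × ℕ => f p.1 (p.2 + 1))) : PT (fun p : γ × ℕ => f p.1 p.2) := by
  refine ptOn_univ.1 (PTOn.branch (T := fun d => d.snd) (.data_snd .id) ?_ ?_)
  · refine PTOn.of_view (V := fun d => d.fst) (.data_fst .id) h0 ?_
    rintro ⟨c, _ | n⟩ ⟨-, h⟩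
    · exact ⟨c, rfl, rfl⟩
    · simp [Data.snd] at h
  -- A successor is a pair with first component `nil`, which is stripped here while the context is
  -- kept.
  · refine PTOn.of_view (V := fun d => .cons d.fst d.snd.snd)
      (.data_cons (.data_fst .id) (.data_snd (.data_snd .id))) h1 ?_
    rintro ⟨c, _ | n⟩ ⟨-, h⟩
    · simp [Data.snd] at h
    · exact ⟨(c, n), rfl, rfl⟩

theorem PT.data_cases {f : γ → Data → β} (h0 : PT (fun c => f c .nil))
    (h1 : PT (fun p : γ × Data × Data => f p.1 (.cons p.2.1 p.2.2))) :
    PT (fun p : γ × Data => f p.1 p.2) := by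
  refine ptOn_univ.1 (PTOn.branch (T := fun d => d.snd) (.data_snd .id) ?_ ?_)
  · refine PTOn.of_view (V := fun d => d.fst) (.data_fst .id) h0 ?_
    rintro ⟨c, _ | ⟨a, l⟩⟩ ⟨-, h⟩
    · exact ⟨c, rfl, rfl⟩
    · simp [Data.snd] at h
  · refine PTOn.of_view (V := fun d => d) .id h1 ?_
    rintro ⟨c, _ | ⟨a, l⟩⟩ ⟨-, h⟩
    · simp [Data.snd] at h
    · exact ⟨(c, a, l), rfl, rfl⟩

/-! ### Loops -/

/-- A loop that runs until the list in the state is empty; `Inv c n s` says that `s` is a state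
in the computation on `c` with `n` rounds to go. -/
theorem PT.loop {f : List α × β → List α × β} (hf : PT f) {g : γ → List α × β} (hg : PT g)
    (res : γ → β) (Inv : γ → ℕ → List α × β → Prop) (N : γ → ℕ) (q : Polynomial ℕ)
    (hN : ∀ c, N c ≤ q.eval (sz c)) (start : ∀ c, Inv c (N c) (g c))
    (step : ∀ c n s, Inv c (n + 1) s → s.1 ≠ [] ∧ Inv c n (f s))
    (halt : ∀ c s, Inv c 0 s → s.1 = [] ∧ s.2 = res c)
    (bound : ∀ c n s, Inv c n s → sz s ≤ q.eval (sz c)) : PT res := by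
  obtain ⟨p, r, hp⟩ := hf
  -- Per round, the body costs at most `r.eval (q.eval (sz c))`; the test by `fst` reads the state
  -- and writes a part of it, and the loop itself is charged one more copy of the state. This gives
  -- the three copies of `q`.
  have key : ∀ c n s, Inv c n s → ∃ (s' : List α × β) (t : ℕ), s'.2 = res c ∧ Run (.while .fst p) (enc s) (enc s') t ∧
      t ≤ (n + 1) * (r.eval (q.eval (sz c)) + 3 * q.eval (sz c) + 1) := by
    intro c n
    induction n with
    | zero =>
      intro s hs
      obtain ⟨h1, h2⟩ := halt c s hs
      have hb := bound c 0 s hs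
      obtain ⟨l, b⟩ := s
      subst h1
      refine ⟨_, _, h2, .while_done (.fst (enc (([] : List α), b))), ?_⟩
      simp only [sz, Data.fst, enc_prod, enc_list_nil, Data.size] at *
      nlinarith
    | succ n ih =>
      intro s hs
      obtain ⟨h1, h2⟩ := step c n s hs
      have hb := bound c _ s hs
      obtain ⟨s', t, hs', ht, htn⟩ := ih _ h2
      obtain ⟨t1, ht1, ht1n⟩ := hp s
      obtain ⟨l, b⟩ := s
      cases l with
      | nil => exact absurd rfl h1
      | cons a l =>
        refine ⟨s', _, hs', .while_step (.fst (enc (a :: l, b))) ht1 ht, ?_⟩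
        have h3 : r.eval (sz (a :: l, b)) ≤ r.eval (q.eval (sz c)) := eval_mono _ hb
        have h4 : (Data.fst (enc (a :: l, b))).size ≤ sz (a :: l, b) := by
          simp only [sz, Data.fst, enc_prod, Data.size]; omega
        have h5 : (enc (a :: l, b)).size = sz (a :: l, b) := rfl
        rw [h5]
        nlinarith
  have main : PT (fun c => Data.cons .nil (enc (res c))) := by
    obtain ⟨pg, rg, hg⟩ := hg
    have hrun : ∀ c, ∃ s' : List α × β, s'.2 = res c := fun c => by
      obtain ⟨s', _, h, _⟩ := key c _ _ (start c); exact ⟨s', h⟩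
    refine ⟨.comp pg (.comp (.while .fst p) (.pair .nil .snd)),
      rg + ((q + 1) * (r.comp q + 3 * q + 1) + 8 * ((q + 1) * (r.comp q + 3 * q + 1)) + 10),
      fun c => ?_⟩
    obtain ⟨t0, h0, h0t⟩ := hg c
    obtain ⟨s', t, hs', ht, htn⟩ := key c _ _ (start c)
    have hle := ht.size_le
    have e : enc s' = .cons (enc s'.1) (enc (res c)) := by rw [← hs']; rfl
    have h2 : Run .snd (enc s') (enc (res c)) ((enc s').size + (enc (res c)).size) := by
      have h := Run.snd (enc s')
      rwa [show (enc s').snd = enc (res c) by rw [e]; rfl] at h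
    have h1 := Run.pair (Run.nil (enc s')) h2
    refine ⟨_, .comp h0 (.comp ht h1), ?_⟩
    have hsz : (enc (res c)).size ≤ (enc s').size := by rw [e]; simp only [Data.size]; omega
    simp only [Polynomial.eval_add, Polynomial.eval_comp, Polynomial.eval_one, Polynomial.eval_mul,
      Polynomial.eval_ofNat, Data.size, e] at *
    have : (N c + 1) * (r.eval (q.eval (sz c)) + 3 * q.eval (sz c) + 1) ≤
      (q.eval (sz c) + 1) * (r.eval (q.eval (sz c)) + 3 * q.eval (sz c) + 1) :=
      Nat.mul_le_mul_right _ (by have := hN c; omega)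
    omega
  exact .of_enc (.data_snd main)

/-- The loop state holds the unread part of the list, the context and the accumulator. The values on
all prefixes have to be bounded, since a polynomial-time step alone could square the size each time.
-/
theorem PT.foldl {l : γ → List α} {i : γ → β} {f : γ → β → α → β} (hl : PT l) (hi : PT i)
    (hf : PT (fun p : γ × β × α => f p.1 p.2.1 p.2.2)) (q : Polynomial ℕ)
    (hq : ∀ c u v, l c = u ++ v → sz (u.foldl (f c) (i c)) ≤ q.eval (sz c)) :
    PT (fun c => (l c).foldl (f c) (i c)) := by
  obtain ⟨ql, hql⟩ := hl.sz_le
  let step : List α × γ × β → List α × γ × β := fun s =>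
    match s.1 with
    | [] => ([], s.2)
    | a :: l => (l, s.2.1, f s.2.1 s.2.2 a)
  have hstep : PT step := by
    have h : PT (fun p : (γ × β) × List α => step (p.2, p.1)) := by
      refine PT.list_cases (f := fun c l => step (l, c)) ?_ ?_
      · show PT (fun c : γ × β => (([] : List α), c)); fun_prop
      · show PT (fun p : (γ × β) × α × List α => (p.2.2, p.1.1, f p.1.1 p.1.2 p.2.1))
        have := PT.comp hf (f := fun p : (γ × β) × α × List α => (p.1.1, p.1.2, p.2.1))
          (by fun_prop)
        fun_prop
    exact PT.comp h (f := fun s : List α × γ × β => (s.2, s.1)) (by fun_prop)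
  have h := PT.loop (res := fun c => (c, (l c).foldl (f c) (i c))) hstep
    (g := fun c => (l c, c, i c)) (by fun_prop)
    (fun c n s => s.1.length = n ∧ s.2.1 = c ∧
      ∃ u, l c = u ++ s.1 ∧ s.2.2 = u.foldl (f c) (i c))
    (fun c => (l c).length) (ql + .X + q + 2) ?_ ?_ ?_ ?_ ?_
  · exact PT.snd h
  · intro c
    have := hql c
    have := length_le_sz (l c)
    simp; omega
  · intro c
    exact ⟨rfl, rfl, [], rfl, rfl⟩
  · rintro c n ⟨l', c', b⟩ ⟨h1, h2, u, h3, h4⟩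
    cases l' with
    | nil => simp at h1
    | cons a l' =>
      simp only at h2 h3 h4
      subst h2 h4
      refine ⟨by simp, by simpa [step] using h1, rfl, u ++ [a], ?_, ?_⟩
      · simpa [step] using h3
      · simp [step]
  · rintro c ⟨l', c', b⟩ ⟨h1, h2, u, h3, h4⟩
    obtain rfl := List.length_eq_zero_iff.1 h1
    simp only at h2 h3 h4
    subst h2 h4
    simp [h3]
  · rintro c n ⟨l', c', b⟩ ⟨h1, h2, u, h3, h4⟩
    simp only at h2 h3 h4
    subst h2 h4
    have h5 := hq _ _ _ h3
    have h6 := hql c'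
    have h7 : sz l' ≤ sz (l c') := by
      rw [h3]
      clear h3 h5 h1
      induction u with
      | nil => simp
      | cons a u ih => simp; omega
    simp
    omega

@[fun_prop]
theorem PT.reverse {l : γ → List α} (hl : PT l) : PT (fun c => (l c).reverse) := by
  obtain ⟨ql, hql⟩ := hl.sz_le
  have h := PT.foldl (f := fun (_ : γ) (s : List α) a => a :: s) hl (i := fun _ => [])
    (by fun_prop) (by fun_prop) ql ?_
  · simpa using h
  · intro c u v h
    refine le_trans ?_ (hql c)
    rw [h]
    -- Generalised to an arbitrary accumulator: moving entries between lists preserves the total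
    -- size.
    suffices ∀ s : List α, sz (u.foldl (fun s a => a :: s) s) + 1 ≤ sz (u ++ v) + sz s by
      have := this []
      simp at this
      simpa using this
    clear h
    induction u with
    | nil => intro s; have := sz_pos v; simp; omega
    | cons a u ih =>
      intro s
      have := ih (a :: s)
      simp at *
      omega

theorem PT.foldr {l : γ → List α} {i : γ → β} {f : γ → α → β → β} (hl : PT l) (hi : PT i)
    (hf : PT (fun p : γ × α × β => f p.1 p.2.1 p.2.2)) (q : Polynomial ℕ)
    (hq : ∀ c u v, l c = u ++ v → sz (v.foldr (f c) (i c)) ≤ q.eval (sz c)) :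
    PT (fun c => (l c).foldr (f c) (i c)) := by
  have h := PT.foldl (l := fun c => (l c).reverse) (f := fun c b a => f c a b) (by fun_prop) hi
    (PT.comp hf (f := fun p : γ × β × α => (p.1, p.2.2, p.2.1)) (by fun_prop)) q ?_
  · simpa using h
  · intro c u v h
    have := hq c v.reverse u.reverse (by
      rw [← List.reverse_append, ← h, List.reverse_reverse])
    simpa using this

/-! ### Recursion on trees -/

/-- The elements of `α` are seen as trees, with a list of immediate subtrees. -/
structure TreeView (kids : α → List α) (m : α → ℕ) : Prop where
  push : PT (fun p : α × List α => kids p.1 ++ p.2)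
  lt : ∀ x, ((kids x).map m).sum < m x
  sz_le : ∀ x, ∀ y ∈ kids x, sz y ≤ sz x
  m_le : ∀ x, m x ≤ sz x

section
variable {kids : α → List α} {m : α → ℕ} {pre : α → List α}

theorem TreeView.length_le (T : TreeView kids m) (w : List α) : w.length ≤ (w.map m).sum := by
  induction w with
  | nil => simp
  | cons a w ih => have := T.lt a; simp; omega

/-- Deleting the root at the front of a traversal exposes its children, and these weigh less than
the root. This controls all intermediate stacks of the evaluation in `TreeView.pt_rec`. -/
theorem TreeView.suffix (T : TreeView kids m) (hpre : ∀ x, pre x = x :: (kids x).flatMap pre)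
    {B : ℕ} (u v : List α) (w : List α) (h : u ++ v = w.flatMap pre) (hB : ∀ y ∈ w, sz y ≤ B) :
    ∃ w' : List α, v = w'.flatMap pre ∧ (w'.map m).sum ≤ (w.map m).sum ∧ ∀ y ∈ w', sz y ≤ B := by
  induction u generalizing w with
  | nil => exact ⟨w, h, le_rfl, hB⟩
  | cons a u ih =>
    cases w with
    | nil => simp at h
    | cons x w =>
      rw [List.flatMap_cons, hpre] at h
      simp only [List.cons_append, List.cons.injEq] at h
      obtain ⟨rfl, h⟩ := h
      obtain ⟨w', h1, h2, h3⟩ := ih (kids a ++ w) (by simp [h]) (by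
        intro y hy
        rcases List.mem_append.1 hy with hy | hy
        · exact (T.sz_le a y hy).trans (hB a (by simp))
        · exact hB y (by simp [hy]))
      refine ⟨w', h1, h2.trans ?_, h3⟩
      have := T.lt a
      simp
      omega

/-- Depth-first search: pop a tree, record it, push its children. The rounds to go are the nodes not
yet visited, at most `m x` in number; the same weight bounds the height of the stack. -/
theorem TreeView.pt_preorder (T : TreeView kids m)
    (hpre : ∀ x, pre x = x :: (kids x).flatMap pre) : PT pre := by
  let step : List α × List α → List α × List α := fun s =>
    match s.1 with
    | [] => ([], s.2)
    | a :: l => (kids a ++ l, a :: s.2)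
  have hstep : PT step := by
    have h : PT (fun p : List α × List α => step (p.2, p.1)) := by
      refine PT.list_cases (f := fun c l => step (l, c)) ?_ ?_
      · show PT (fun c : List α => (([] : List α), c)); fun_prop
      · show PT (fun p : List α × α × List α => (kids p.2.1 ++ p.2.2, p.2.1 :: p.1))
        have := PT.comp T.push (f := fun p : List α × α × List α => p.2) (by fun_prop)
        fun_prop
    exact PT.comp h (f := fun s : List α × List α => (s.2, s.1)) (by fun_prop)
  have hlen : ∀ (n : ℕ) (w : List α), (w.map m).sum ≤ n →
      (w.flatMap pre).length ≤ (w.map m).sum := by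
    intro n
    induction n with
    | zero =>
      intro w hw
      cases w with
      | nil => simp
      | cons x w => have := T.lt x; simp at hw; omega
    | succ n ih =>
      intro w hw
      cases w with
      | nil => simp
      | cons x w =>
        have h1 := T.lt x
        have h2 := ih (kids x ++ w) (by simp at hw ⊢; omega)
        rw [List.flatMap_cons, hpre]
        simp only [List.flatMap_append, List.length_append, List.map_append, List.sum_append,
          List.cons_append, List.length_cons, List.map_cons, List.sum_cons] at *
        omega
  have h := PT.loop (res := fun x => (pre x).reverse) hstep
    (g := fun x => ([x], [])) (by fun_prop)
    (fun x n s => (s.1.flatMap pre).length = n ∧ s.2.reverse ++ s.1.flatMap pre = pre x ∧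
      (s.1.map m).sum ≤ m x ∧ (∀ y ∈ s.1, sz y ≤ sz x) ∧ ∀ y ∈ s.2, sz y ≤ sz x)
    (fun x => (pre x).length) (.X + 2 * (.X * (.X + 1) + 1) + 1) ?_ ?_ ?_ ?_ ?_
  · simpa using h.reverse
  · intro x
    have := hlen _ [x] le_rfl
    have := T.m_le x
    simp at *
    omega
  · intro x
    simp
  · rintro x n ⟨w, acc⟩ ⟨h1, h2, h3, h4, h5⟩
    cases w with
    | nil => simp at h1
    | cons y w =>
      simp only [List.flatMap_cons] at h1 h2
      rw [hpre y] at h1 h2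
      have hy := h4 y (by simp)
      refine ⟨by simp, ?_, ?_, ?_, ?_, ?_⟩
      · simpa [step] using h1
      · simpa [step] using h2
      · have := T.lt y
        simp [step] at h3 ⊢
        omega
      · intro z hz
        rcases List.mem_append.1 hz with hz | hz
        · exact (T.sz_le y z hz).trans hy
        · exact h4 z (by simp [hz])
      · intro z hz
        rcases List.mem_cons.1 hz with rfl | hz
        · exact hy
        · exact h5 z hz
  · rintro x ⟨w, acc⟩ ⟨h1, h2, h3, h4, h5⟩
    cases w with
    | nil => simpa [List.reverse_eq_iff] using h2
    | cons y w => rw [List.flatMap_cons, hpre y] at h1; simp at h1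
  · rintro x n ⟨w, acc⟩ ⟨h1, h2, h3, h4, h5⟩
    have e1 := sz_list_le h4
    have e2 := sz_list_le h5
    have e3 := T.length_le w
    have e4 := T.m_le x
    have e5 : acc.length ≤ sz x := by
      have e6 := congrArg List.length h2
      have e7 := hlen _ [x] le_rfl
      simp at e6 e7
      omega
    simp only [sz_prod, Polynomial.eval_add, Polynomial.eval_mul, Polynomial.eval_X,
      Polynomial.eval_one, Polynomial.eval_ofNat] at *
    have e8 : w.length * (sz x + 1) ≤ sz x * (sz x + 1) := Nat.mul_le_mul_right _ (by omega)
    have e9 : acc.length * (sz x + 1) ≤ sz x * (sz x + 1) := Nat.mul_le_mul_right _ e5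
    omega

/-- Recursion on trees. The function `K` replaces the values of the immediate subtrees on top of a
stack by the value of the tree. -/
theorem TreeView.pt_rec (T : TreeView kids m) {V : γ → α → β}
    {K : γ → α → List β → List β} (hK : PT (fun p : γ × α × List β => K p.1 p.2.1 p.2.2))
    (hV : ∀ c x s, K c x ((kids x).map (V c) ++ s) = V c x :: s) (q : Polynomial ℕ)
    (hq : ∀ c x, sz (V c x) ≤ ((kids x).map fun y => sz (V c y)).sum + q.eval (sz c + sz x)) :
    PT (fun p : γ × α => V p.1 p.2) := by
  obtain ⟨pre, hpre⟩ := exists_preorder T.lt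
  have hP := T.pt_preorder hpre
  have hm : ∀ x, ∀ y ∈ kids x, m y < m x := fun x y hy =>
    (List.single_le_sum (by simp) _ (List.mem_map_of_mem hy)).trans_lt (T.lt x)
  -- The tree has at most `m x` nodes, and each adds at most the same polynomial amount to the size
  -- of the value.
  have hbound : ∀ c n x, m x ≤ n → sz (V c x) ≤ m x * q.eval (sz c + sz x) := by
    intro c n
    induction n with
    | zero => intro x hx; have := T.lt x; omega
    | succ n ih =>
      intro x hx
      have h1 := hq c x
      have h2 : ((kids x).map fun y => sz (V c y)).sum ≤
          ((kids x).map m).sum * q.eval (sz c + sz x) := by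
        rw [← List.sum_map_mul_right]
        refine List.sum_le_sum fun y hy => ?_
        refine (ih y (by have := hm x y hy; omega)).trans ?_
        exact Nat.mul_le_mul_left _ (eval_mono _ (by have := T.sz_le x y hy; omega))
      have h3 := T.lt x
      nlinarith
  -- Read from the right, a preorder list is a program for a stack machine: when a node is reached,
  -- the values of its children are on top of the stack.
  have hfold : ∀ c n (w : List α), (w.map m).sum ≤ n →
      (w.flatMap pre).foldr (K c) [] = w.map (V c) := by
    intro c n
    induction n with
    | zero =>
      intro w hw
      cases w with
      | nil => simp
      | cons x w => have := T.lt x; simp at hw; omega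
    | succ n ih =>
      intro w hw
      cases w with
      | nil => simp
      | cons x w =>
        have h1 := T.lt x
        have h2 := ih (kids x ++ w) (by simp at hw ⊢; omega)
        rw [List.flatMap_cons, hpre, List.cons_append, List.foldr_cons, ← List.flatMap_append, h2,
          List.map_append, hV, List.map_cons]
  have key : PT (fun p : γ × α => (pre p.2).foldr (K p.1) []) := by
    refine PT.foldr (f := fun p : γ × α => K p.1) (PT.comp hP (by fun_prop)) (by fun_prop)
      (PT.comp hK (f := fun p : (γ × α) × α × List β => (p.1.1, p.2.1, p.2.2)) (by fun_prop))
      (.X * (.X * q + 1) + 1) ?_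
    rintro ⟨c, x⟩ u v h
    -- Each intermediate stack consists of the values of a forest of total weight at most `m x`, so
    -- both its length and its entries are bounded.
    obtain ⟨w, h1, h2, h3⟩ := T.suffix hpre (B := sz x) u v [x] (by simp [← h]) (by simp)
    rw [h1, hfold c _ w le_rfl]
    have e1 : ∀ b ∈ w.map (V c), sz b ≤ sz (c, x) * q.eval (sz (c, x)) := by
      intro b hb
      obtain ⟨y, hy, rfl⟩ := List.mem_map.1 hb
      refine (hbound c _ y le_rfl).trans ?_
      have := T.m_le y
      have := h3 y hy
      exact Nat.mul_le_mul (by simp; omega) (eval_mono _ (by simp; omega))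
    refine (sz_list_le e1).trans ?_
    have e2 := T.length_le w
    have e3 := T.m_le x
    simp only [Polynomial.eval_add, Polynomial.eval_mul, Polynomial.eval_X, Polynomial.eval_one,
      List.length_map, add_le_add_iff_right]
    refine Nat.mul_le_mul_right _ ?_
    simp at h2 ⊢
    omega
  have e : (fun p : γ × α => enc (V p.1 p.2)) =
      fun p => (enc ((pre p.2).foldr (K p.1) [])).fst := by
    funext p
    have := hfold p.1 _ [p.2] le_rfl
    simp only [List.flatMap_cons, List.flatMap_nil, List.append_nil] at this
    rw [this]
    rfl
  refine .of_enc ?_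
  rw [e]
  exact .data_fst key.to_enc

end
end
section
variable {α β γ δ : Type} [Enc α] [Enc β] [Enc γ] [Enc δ]

/-! ### Recursion on lists and numbers -/

theorem treeView_list : TreeView (fun l : List α => l.casesOn [] fun _ l => [l]) sz where
  push := by
    have := PT.list_cases (γ := List (List α)) (f := fun c (l : List α) =>
      (l.casesOn [] fun _ l => [l] : List (List α)) ++ c) (by simp; fun_prop) (by simp; fun_prop)
    exact PT.comp this (f := fun p : List α × List (List α) => (p.2, p.1)) (by fun_prop)
  lt l := by cases l <;> simp
  sz_le l := by cases l <;> simp; omega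
  m_le _ := le_rfl

theorem treeView_nat : TreeView (fun n : ℕ => n.casesOn [] fun n => [n]) sz where
  push := by
    have := PT.nat_cases (γ := List ℕ) (f := fun c (l : ℕ) =>
      (l.casesOn [] fun l => [l] : List ℕ) ++ c) (by simp; fun_prop) (by simp; fun_prop)
    exact PT.comp this (f := fun p : ℕ × List ℕ => (p.2, p.1)) (by fun_prop)
  lt l := by cases l <;> simp
  sz_le l := by cases l <;> simp
  m_le _ := le_rfl

/-- A list is seen as a tree whose only child is its tail. The growth condition is additive: each
entry may add a polynomial amount, but may not multiply the value for the tail. -/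
theorem PT.list_rec {V : γ → List α → β} {f : γ → α → List α → β → β}
    (h0 : PT fun c => V c [])
    (hf : PT fun p : γ × α × List α × β => f p.1 p.2.1 p.2.2.1 p.2.2.2)
    (hV : ∀ c a l, V c (a :: l) = f c a l (V c l)) (q : Polynomial ℕ)
    (hq : ∀ c a l, sz (V c (a :: l)) ≤ sz (V c l) + q.eval (sz c + sz (a :: l))) :
    PT fun p : γ × List α => V p.1 p.2 := by
  obtain ⟨q0, hq0⟩ := h0.sz_le
  -- The default `[]` for an empty stack is never used: at a nonempty list the value of the tail is
  -- on the stack.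
  refine treeView_list.pt_rec (K := fun c x (s : List β) => x.casesOn (V c [] :: s)
    fun a l => s.casesOn [] fun v s => f c a l v :: s) ?_ ?_ (q + q0) ?_
  · have h1 : PT fun p : (γ × α × List α) × List β =>
        (p.2.casesOn [] fun v s => f p.1.1 p.1.2.1 p.1.2.2 v :: s : List β) := by
      refine PT.list_cases (f := fun (c : γ × α × List α) (s : List β) =>
        (s.casesOn [] fun v s => f c.1 c.2.1 c.2.2 v :: s : List β)) (.const _) ?_
      have := PT.comp hf (f := fun p : (γ × α × List α) × β × List β =>
        (p.1.1, p.1.2.1, p.1.2.2, p.2.1)) (by fun_prop)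
      fun_prop
    have h2 := PT.list_cases (γ := γ × List β) (f := fun c (x : List α) =>
      (x.casesOn (V c.1 [] :: c.2)
        fun a l => c.2.casesOn [] fun v s => f c.1 a l v :: s : List β)) (by fun_prop)
      (PT.comp h1 (f := fun p : (γ × List β) × α × List α => ((p.1.1, p.2), p.1.2)) (by fun_prop))
    exact PT.comp h2 (f := fun p : γ × List α × List β => ((p.1, p.2.2), p.2.1)) (by fun_prop)
  · intro c x s
    cases x <;> simp [hV]
  · intro c x
    cases x with
    | nil =>
      have := hq0 c
      have := eval_mono q0 (show sz c ≤ sz c + sz ([] : List α) by simp)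
      simp at *; omega
    | cons a l =>
      have := hq c a l
      simp at *; omega

theorem PT.nat_rec {V : γ → ℕ → β} {f : γ → ℕ → β → β}
    (h0 : PT fun c => V c 0)
    (hf : PT fun p : γ × ℕ × β => f p.1 p.2.1 p.2.2)
    (hV : ∀ c n, V c (n + 1) = f c n (V c n)) (q : Polynomial ℕ)
    (hq : ∀ c n, sz (V c (n + 1)) ≤ sz (V c n) + q.eval (sz c + sz n)) :
    PT fun p : γ × ℕ => V p.1 p.2 := by
  obtain ⟨q0, hq0⟩ := h0.sz_le
  refine treeView_nat.pt_rec (K := fun c x (s : List β) => x.casesOn (V c 0 :: s)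
    fun n => s.casesOn [] fun v s => f c n v :: s) ?_ ?_ (q + q0) ?_
  · have h1 : PT fun p : (γ × ℕ) × List β =>
        (p.2.casesOn [] fun v s => f p.1.1 p.1.2 v :: s : List β) := by
      refine PT.list_cases (f := fun (c : γ × ℕ) (s : List β) =>
        (s.casesOn [] fun v s => f c.1 c.2 v :: s : List β)) (.const _) ?_
      have := PT.comp hf (f := fun p : (γ × ℕ) × β × List β =>
        (p.1.1, p.1.2, p.2.1)) (by fun_prop)
      fun_prop
    have h2 := PT.nat_cases (γ := γ × List β) (f := fun c (x : ℕ) =>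
      (x.casesOn (V c.1 0 :: c.2)
        fun n => c.2.casesOn [] fun v s => f c.1 n v :: s : List β)) (by fun_prop)
      (PT.comp h1 (f := fun p : (γ × List β) × ℕ => ((p.1.1, p.2), p.1.2)) (by fun_prop))
    exact PT.comp h2 (f := fun p : γ × ℕ × List β => ((p.1, p.2.2), p.2.1)) (by fun_prop)
  · intro c x s
    cases x <;> simp [hV]
  · intro c x
    cases x with
    | zero =>
      have := hq0 c
      have := eval_mono q0 (show sz c ≤ sz c + sz 0 by simp)
      simp at *; omega
    | succ n =>
      have := hq c n
      have := eval_mono q (show sz c + sz n ≤ sz c + sz (n + 1) by simp)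
      simp at *; omega

@[fun_prop]
theorem PT.append {f g : γ → List α} (hf : PT f) (hg : PT g) : PT fun c => f c ++ g c := by
  have := PT.list_rec (V := fun (c l : List α) => l ++ c) (f := fun _ a _ v => a :: v)
    (by simp; fun_prop) (by fun_prop) (by simp) .X (by simp; omega)
  exact PT.comp this (f := fun c => (g c, f c)) (by fun_prop)

theorem sz_append (l l' : List α) : sz (l ++ l') ≤ sz l + sz l' := by
  induction l with
  | nil => simp
  | cons a l ih => simp; omega

@[fun_prop]
theorem PT.map {l : γ → List α} {f : γ → α → β} (hl : PT l)
    (hf : PT fun p : γ × α => f p.1 p.2) : PT fun c => (l c).map (f c) := by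
  obtain ⟨q, hq⟩ := hf.sz_le
  have := PT.list_rec (V := fun c l => List.map (f c) l) (f := fun c a _ v => f c a :: v)
    (by simp; fun_prop)
    (by
      have := PT.comp hf (f := fun p : γ × α × List α × List β => (p.1, p.2.1)) (by fun_prop)
      fun_prop) (by simp) (q + 1) (by
      intro c a l
      have h1 := hq (c, a)
      have h2 := eval_mono q (show sz (c, a) ≤ sz c + sz (a :: l) by simp)
      simp at *
      omega)
  exact PT.comp this (f := fun c => (c, l c)) (by fun_prop)

@[fun_prop]
theorem PT.flatMap {l : γ → List α} {f : γ → α → List β} (hl : PT l)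
    (hf : PT fun p : γ × α => f p.1 p.2) : PT fun c => (l c).flatMap (f c) := by
  obtain ⟨q, hq⟩ := hf.sz_le
  have := PT.list_rec (V := fun c l => List.flatMap (f c) l) (f := fun c a _ v => f c a ++ v)
    (by simp; fun_prop)
    (by
      have := PT.comp hf (f := fun p : γ × α × List α × List β => (p.1, p.2.1)) (by fun_prop)
      fun_prop) (by simp) q (by
      intro c a l
      have h1 := hq (c, a)
      have h2 := eval_mono q (show sz (c, a) ≤ sz c + sz (a :: l) by simp)
      have h3 := sz_append (f c a) (l.flatMap (f c))
      simp at *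
      omega)
  exact PT.comp this (f := fun c => (c, l c)) (by fun_prop)

@[fun_prop]
theorem PT.length {l : γ → List α} (hl : PT l) : PT fun c => (l c).length := by
  have := PT.list_rec (γ := List α) (V := fun _ l => List.length l) (f := fun _ (_ : α) _ v => v + 1)
    (by simp; fun_prop) (by fun_prop) (by simp) 2 (by simp)
  exact PT.comp this (f := fun c => (l c, l c)) (by fun_prop)

@[fun_prop]
theorem PT.range {f : γ → ℕ} (hf : PT f) : PT fun c => List.range (f c) := by
  have := PT.nat_rec (γ := ℕ) (V := fun _ n => List.range n) (f := fun _ n v => v ++ [n])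
    (by simp; fun_prop) (by fun_prop) (by simp [List.range_succ]) (.X + 2) (by
      intro c n
      have := sz_append (List.range n) [n]
      simp [List.range_succ] at *
      omega)
  exact PT.comp this (f := fun c => (f c, f c)) (by fun_prop)

@[fun_prop]
theorem PT.replicate {f : γ → ℕ} {g : γ → β} (hf : PT f) (hg : PT g) :
    PT fun c => List.replicate (f c) (g c) := by
  have := PT.nat_rec (γ := β) (V := fun b n => List.replicate n b) (f := fun b _ v => b :: v)
    (by simp; fun_prop) (by fun_prop) (by simp [List.replicate_succ]) (.X + 1) (by
      intro c n
      simp [List.replicate_succ] at *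
      omega)
  exact PT.comp this (f := fun c => (g c, f c)) (by fun_prop)

theorem sz_add (m n : ℕ) : sz (m + n) ≤ sz m + sz n := by
  induction n with
  | zero => simp
  | succ n ih => rw [← add_assoc]; simp; omega

@[fun_prop]
theorem PT.add {f g : γ → ℕ} (hf : PT f) (hg : PT g) : PT fun c => f c + g c := by
  have := PT.nat_rec (γ := ℕ) (V := fun m n => m + n) (f := fun _ _ v => v + 1)
    (by simp; fun_prop) (by fun_prop) (by intros; omega) 2 (by
      intro c n
      rw [← add_assoc]
      simp)
  exact PT.comp this (f := fun c => (f c, g c)) (by fun_prop)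

/-- The amount added in one step does not depend on the accumulator, so the bound on intermediate
values demanded by `PT.foldl` comes for free. -/
theorem PT.foldl_add {l : γ → List α} {i : γ → β} {f : γ → β → α → β} (hl : PT l) (hi : PT i)
    (hf : PT fun p : γ × β × α => f p.1 p.2.1 p.2.2) (q : Polynomial ℕ)
    (hq : ∀ c b a, sz (f c b a) ≤ sz b + q.eval (sz c + sz a)) :
    PT fun c => (l c).foldl (f c) (i c) := by
  have := PT.list_rec (V := fun (c : γ × β) l => l.foldr (fun a b => f c.1 b a) c.2)
    (f := fun c a _ v => f c.1 v a) (by simp; fun_prop)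
    (PT.comp hf (f := fun p : (γ × β) × α × List α × β => (p.1.1, p.2.2.2, p.2.1)) (by fun_prop))
    (by simp) q (by
      intro c a l
      have h1 := hq c.1 (l.foldr (fun a b => f c.1 b a) c.2) a
      have h2 := eval_mono q (show sz c.1 + sz a ≤ sz c + sz (a :: l) by
        obtain ⟨c, b⟩ := c; simp; omega)
      simp at *
      omega)
  have := PT.comp this (f := fun c => ((c, i c), (l c).reverse)) (by fun_prop)
  simpa using this

/-! ### Equality -/

/-- Equality is decidable in polynomial time. -/
class EqPT (α : Type) [Enc α] [DecidableEq α] : Prop where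
  pt : PT fun p : α × α => decide (p.1 = p.2)

@[fun_prop]
theorem PT.eq [DecidableEq α] [EqPT α] {f g : γ → α} (hf : PT f) (hg : PT g) :
    PT fun c => decide (f c = g c) :=
  PT.comp EqPT.pt (f := fun c => (f c, g c)) (by fun_prop)

@[fun_prop]
theorem PT.mem [DecidableEq α] [EqPT α] {f : γ → α} {l : γ → List α} (hf : PT f) (hl : PT l) :
    PT fun c => decide (f c ∈ l c) := by
  have := PT.list_rec (γ := α) (V := fun a l => decide (a ∈ l))
    (f := fun a b _ v => bif decide (a = b) then true else v)
    (by simp; fun_prop) (by fun_prop)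
    (by intro c a l; by_cases h : c = a <;> simp [h]) 2 (by
      intro c a l
      have := sz_bool_le (decide (c ∈ a :: l))
      have := sz_pos (decide (c ∈ l))
      simp at *
      omega)
  exact PT.comp this (f := fun c => (f c, l c)) (by fun_prop)

@[fun_prop]
theorem PT.dedup [DecidableEq α] [EqPT α] {l : γ → List α} (hl : PT l) :
    PT fun c => (l c).dedup := by
  have key : ∀ (a : α) l, (a :: l).dedup = bif decide (a ∈ l) then l.dedup else a :: l.dedup := by
    intro a l
    by_cases h : a ∈ l
    · simp [List.dedup_cons_of_mem h, h]
    · simp [List.dedup_cons_of_notMem h, h]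
  have := PT.list_rec (γ := List α) (V := fun _ (l : List α) => l.dedup)
    (f := fun _ a l v => bif decide (a ∈ l) then v else a :: v)
    (by simp; fun_prop) (by fun_prop) (by simp [key]) (.X + 1) (by
      intro c a l
      rw [key]
      by_cases h : a ∈ l <;> simp [h]
      omega)
  exact PT.comp this (f := fun c => (l c, l c)) (by fun_prop)

@[fun_prop]
theorem PT.idxOf [DecidableEq α] [EqPT α] {f : γ → α} {l : γ → List α} (hf : PT f) (hl : PT l) :
    PT fun c => (l c).idxOf (f c) := by
  have key : ∀ (a b : α) l, (b :: l).idxOf a = bif decide (a = b) then 0 else l.idxOf a + 1 := by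
    intro a b l
    rw [List.idxOf_cons]
    by_cases h : a = b
    · simp [h]
    · simp [h, beq_false_of_ne (Ne.symm h)]
  have := PT.list_rec (γ := α) (V := fun a l => l.idxOf a)
    (f := fun a b _ v => bif decide (a = b) then 0 else v + 1)
    (by simp; fun_prop) (by fun_prop) (by simp [key]) 2 (by
      intro c a l
      rw [key]
      by_cases h : c = a
      · have := sz_pos (l.idxOf c)
        simp [h] at *
      · simp [h])
  exact PT.comp this (f := fun c => (f c, l c)) (by fun_prop)
end

theorem EqPT.of_injective {α : Type} [Enc α] [DecidableEq α] [EqPT Data]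
    (h : Function.Injective (enc : α → Data)) : EqPT α where
  pt := by
    have e : (fun p : α × α => decide (p.1 = p.2)) = fun p => decide (enc p.1 = enc p.2) := by
      funext p; simp [h.eq_iff]
    rw [e]
    exact PT.eq (PT.fst .id).to_enc (PT.snd .id).to_enc

/-! ### Trees -/

theorem treeView_data : TreeView (fun d : Data => d.casesOn [] fun a b => [a, b]) sz where
  push := by
    have := PT.data_cases (γ := List Data) (f := fun c d =>
      (d.casesOn [] fun a b => [a, b] : List Data) ++ c) (by simp; fun_prop) (by simp; fun_prop)
    exact PT.comp this (f := fun p : Data × List Data => (p.2, p.1)) (by fun_prop)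
  lt d := by cases d <;> simp
  sz_le d := by cases d <;> simp; omega
  m_le _ := le_rfl

/-- Pairs of trees are traversed in parallel, which makes the equality test for trees a recursion of
the same kind. -/
theorem treeView_data_prod : TreeView (fun p : Data × Data =>
    p.1.casesOn [] fun a b => p.2.casesOn [] fun c d => [(a, c), (b, d)]) sz where
  push := by
    have h1 := PT.data_cases (γ := List (Data × Data) × Data × Data) (f := fun c z =>
      (z.casesOn [] fun x y => [(c.2.1, x), (c.2.2, y)] : List (Data × Data)) ++ c.1)
      (by simp; fun_prop) (by simp; fun_prop)
    have h2 := PT.data_cases (γ := List (Data × Data) × Data) (f := fun c d =>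
      (d.casesOn [] fun a b => c.2.casesOn [] fun x y => [(a, x), (b, y)] : List (Data × Data))
        ++ c.1) (by simp; fun_prop)
      (PT.comp h1 (f := fun p : (List (Data × Data) × Data) × Data × Data =>
        ((p.1.1, p.2), p.1.2)) (by fun_prop))
    exact PT.comp h2 (f := fun p : (Data × Data) × List (Data × Data) => ((p.2, p.1.2), p.1.1))
      (by fun_prop)
  lt p := by
    obtain ⟨a | ⟨a, b⟩, c | ⟨c, d⟩⟩ := p <;> simp
    omega
  sz_le p := by
    obtain ⟨a | ⟨a, b⟩, c | ⟨c, d⟩⟩ := p <;> simp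
    omega
  m_le _ := le_rfl

theorem pt_data_size : PT Data.size := by
  have h := treeView_data.pt_rec (γ := Data) (V := fun _ d => d.size)
    (K := fun _ x (s : List ℕ) => x.casesOn (1 :: s)
      fun _ _ => s.casesOn [] fun u s => s.casesOn [] fun v s => (u + v + 1) :: s) ?_ ?_ 3 ?_
  · exact PT.comp h (f := fun d => (d, d)) (by fun_prop)
  · have h1 := PT.list_cases (γ := ℕ) (f := fun u (s : List ℕ) =>
      (s.casesOn [] fun v s => (u + v + 1) :: s : List ℕ)) (by simp; fun_prop) (by simp; fun_prop)
    have h2 := PT.list_cases (γ := Data) (f := fun _ (s : List ℕ) =>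
      (s.casesOn [] fun u s => s.casesOn [] fun v s => (u + v + 1) :: s : List ℕ))
      (by simp; fun_prop)
      (PT.comp h1 (f := fun p : Data × ℕ × List ℕ => p.2) (by fun_prop))
    have h3 := PT.data_cases (γ := List ℕ) (f := fun s d => (d.casesOn (1 :: s)
      fun _ _ => s.casesOn [] fun u s => s.casesOn [] fun v s => (u + v + 1) :: s : List ℕ))
      (by simp; fun_prop)
      (PT.comp h2 (f := fun p : List ℕ × Data × Data => (p.2.1, p.1)) (by fun_prop))
    exact PT.comp h3 (f := fun p : Data × Data × List ℕ => (p.2.2, p.2.1)) (by fun_prop)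
  · intro c x s
    cases x <;> simp [Data.size]
  · intro c x
    cases x with
    | nil => simp [Data.size]
    | cons a b =>
      have := sz_add a.size b.size
      simp [Data.size] at *
      linarith

instance : EqPT Data where
  pt := by
    have h := treeView_data_prod.pt_rec (γ := Bool) (V := fun _ p => decide (p.1 = p.2))
      (K := fun _ x (s : List Bool) => x.1.casesOn ((x.2.casesOn true fun _ _ => false) :: s)
        fun _ _ => x.2.casesOn (false :: s)
          fun _ _ => s.casesOn [] fun u s => s.casesOn []
            fun v s => (bif u then v else false) :: s) ?_ ?_ 3 ?_
    · exact PT.comp h (f := fun d => (true, d)) (by fun_prop)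
    · have h1 := PT.list_cases (γ := Bool) (f := fun u (s : List Bool) =>
        (s.casesOn [] fun v s => (bif u then v else false) :: s : List Bool))
        (by simp; fun_prop) (by simp only; fun_prop)
      have h2 := PT.list_cases (γ := Data) (f := fun _ (s : List Bool) =>
        (s.casesOn [] fun u s => s.casesOn [] fun v s => (bif u then v else false) :: s :
          List Bool)) (by simp; fun_prop)
        (PT.comp h1 (f := fun p : Data × Bool × List Bool => p.2) (by fun_prop))
      have h3 := PT.data_cases (γ := List Bool) (f := fun s y =>
        (y.casesOn (false :: s) fun _ _ => s.casesOn [] fun u s => s.casesOn []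
          fun v s => (bif u then v else false) :: s : List Bool)) (by simp; fun_prop)
        (PT.comp h2 (f := fun p : List Bool × Data × Data => (p.2.1, p.1)) (by fun_prop))
      have h4 := PT.data_cases (γ := List Bool) (f := fun s y =>
        ((y.casesOn true fun _ _ => false) :: s : List Bool)) (by simp; fun_prop)
        (by simp; fun_prop)
      have h5 := PT.data_cases (γ := List Bool × Data) (f := fun c x =>
        (x.casesOn ((c.2.casesOn true fun _ _ => false) :: c.1)
        fun _ _ => c.2.casesOn (false :: c.1)
          fun _ _ => c.1.casesOn [] fun u s => s.casesOn []
            fun v s => (bif u then v else false) :: s : List Bool)) h4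
        (PT.comp h3 (f := fun p : (List Bool × Data) × Data × Data => p.1) (by fun_prop))
      exact PT.comp h5 (f := fun p : Bool × (Data × Data) × List Bool =>
        ((p.2.2, p.2.1.2), p.2.1.1)) (by fun_prop)
    · rintro c ⟨a | ⟨a, b⟩, x | ⟨x, y⟩⟩ s <;> simp
    · rintro c ⟨x, y⟩
      have := sz_bool_le (decide (x = y))
      simp
      omega

/-! ## Programs on syntax trees -/

section
variable {α β γ δ : Type} [Enc α] [Enc β] [Enc γ] [Enc δ]

/-! ### Constructors of formulas and their sizes. -/

@[fun_prop]
theorem PT.pred_base {f : γ → List Bool} (hf : PT f) : PT fun c => PredName.base (f c) :=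
  .of_enc (.data_cons (.enc_const _) hf.to_enc)

@[fun_prop]
theorem PT.pred_copy {f : γ → PredName} {g : γ → ℕ} (hf : PT f) (hg : PT g) :
    PT fun c => PredName.copy (f c) (g c) :=
  .of_enc (.data_cons (.enc_const _) (.data_cons hf.to_enc hg.to_enc))

@[fun_prop]
theorem PT.pred_stand_none {g : γ → ℕ} (hg : PT g) : PT fun c => PredName.stand none (g c) :=
  .of_enc (.data_cons (.enc_const _) hg.to_enc)

@[fun_prop]
theorem PT.pred_stand_some {f : γ → List Bool} {g : γ → ℕ} (hf : PT f) (hg : PT g) :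
    PT fun c => PredName.stand (some (f c)) (g c) :=
  .of_enc (.data_cons (.enc_const _) (.data_cons hf.to_enc hg.to_enc))

@[fun_prop]
theorem PT.fo_atom {f : γ → PredName} {g : γ → List Term} (hf : PT f) (hg : PT g) :
    PT fun c => FOFormula.atom (f c) (g c) :=
  .of_enc (.data_cons (.enc_const _) (.data_cons hf.to_enc hg.to_enc))

@[fun_prop]
theorem PT.fo_neg {f : γ → FOFormula} (hf : PT f) : PT fun c => FOFormula.neg (f c) :=
  .of_enc (.data_cons (.enc_const _) hf.to_enc)

@[fun_prop]
theorem PT.fo_and {f g : γ → FOFormula} (hf : PT f) (hg : PT g) :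
    PT fun c => FOFormula.and (f c) (g c) :=
  .of_enc (.data_cons (.enc_const _) (.data_cons hf.to_enc hg.to_enc))

@[fun_prop]
theorem PT.fo_all {f : γ → List Bool} {g : γ → FOFormula} (hf : PT f) (hg : PT g) :
    PT fun c => FOFormula.all (f c) (g c) :=
  .of_enc (.data_cons (.enc_const _) (.data_cons hf.to_enc hg.to_enc))

@[fun_prop]
theorem PT.atom {f : γ → PredName} {g : γ → List Term} (hf : PT f) (hg : PT g) :
    PT fun c => Formula.atom (f c) (g c) :=
  .of_enc (.data_cons (.enc_const _) (.data_cons hf.to_enc hg.to_enc))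

@[fun_prop]
theorem PT.neg {f : γ → Formula} (hf : PT f) : PT fun c => Formula.neg (f c) :=
  .of_enc (.data_cons (.enc_const _) hf.to_enc)

@[fun_prop]
theorem PT.and {f g : γ → Formula} (hf : PT f) (hg : PT g) :
    PT fun c => Formula.and (f c) (g c) :=
  .of_enc (.data_cons (.enc_const _) (.data_cons hf.to_enc hg.to_enc))

@[fun_prop]
theorem PT.all {f : γ → List Bool} {g : γ → Formula} (hf : PT f) (hg : PT g) :
    PT fun c => Formula.all (f c) (g c) :=
  .of_enc (.data_cons (.enc_const _) (.data_cons hf.to_enc hg.to_enc))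

@[fun_prop]
theorem PT.box {f : γ → StExpr} {g : γ → Formula} (hf : PT f) (hg : PT g) :
    PT fun c => Formula.box (f c) (g c) :=
  .of_enc (.data_cons (.enc_const _) (.data_cons hf.to_enc hg.to_enc))

@[fun_prop]
theorem PT.imp {f g : γ → Formula} (hf : PT f) (hg : PT g) :
    PT fun c => Formula.imp (f c) (g c) := by
  unfold Formula.imp; fun_prop

@[fun_prop]
theorem PT.fo_imp {f g : γ → FOFormula} (hf : PT f) (hg : PT g) :
    PT fun c => FOFormula.imp (f c) (g c) := by
  unfold FOFormula.imp; fun_prop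

@[fun_prop]
theorem PT.fo_or {f g : γ → FOFormula} (hf : PT f) (hg : PT g) :
    PT fun c => FOFormula.or (f c) (g c) := by
  unfold FOFormula.or; fun_prop

@[simp] theorem sz_atom (P : PredName) (ts : List Term) :
    sz (Formula.atom P ts) = sz P + sz ts + 3 := by
  change 1 + (sz P + sz ts + 1) + 1 = _; omega

@[simp] theorem sz_neg (φ : Formula) : sz φ.neg = sz φ + 4 := by
  change 3 + sz φ + 1 = _; omega

@[simp] theorem sz_and (φ ψ : Formula) : sz (φ.and ψ) = sz φ + sz ψ + 7 := by
  change 5 + (sz φ + sz ψ + 1) + 1 = _; omega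

@[simp] theorem sz_all (x : Ident) (φ : Formula) : sz (φ.all x) = sz x + sz φ + 9 := by
  change 7 + (sz x + sz φ + 1) + 1 = _; omega

@[simp] theorem sz_box (e : StExpr) (φ : Formula) : sz (φ.box e) = sz e + sz φ + 11 := by
  change 9 + (sz e + sz φ + 1) + 1 = _; omega

@[simp] theorem sz_fo_neg (φ : FOFormula) : sz φ.neg = sz φ + 4 := by
  change 3 + sz φ + 1 = _; omega

@[simp] theorem sz_fo_and (φ ψ : FOFormula) : sz (φ.and ψ) = sz φ + sz ψ + 7 := by
  change 5 + (sz φ + sz ψ + 1) + 1 = _; omega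

@[simp] theorem sz_fo_all (x : Ident) (φ : FOFormula) : sz (φ.all x) = sz x + sz φ + 9 := by
  change 7 + (sz x + sz φ + 1) + 1 = _; omega

@[simp] theorem sz_union (e f : StExpr) : sz (e.union f) = sz e + sz f + 7 := by
  change 5 + (sz e + sz f + 1) + 1 = _; omega

@[simp] theorem sz_inter (e f : StExpr) : sz (e.inter f) = sz e + sz f + 9 := by
  change 7 + (sz e + sz f + 1) + 1 = _; omega

@[simp] theorem sz_diff (e f : StExpr) : sz (e.diff f) = sz e + sz f + 11 := by
  change 9 + (sz e + sz f + 1) + 1 = _; omega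

/-! ### Case distinction and recursion -/

/-- Case distinction on five tags. -/
theorem PT.of_tags {f : γ × α → β} {S : ℕ → Set (γ × α)}
    (hS : ∀ p, ∃ k < 5, p ∈ S k)
    (hk : ∀ k, ∀ p ∈ S k, (enc p).snd.fst = Data.unary k)
    (h : ∀ k < 5, PTOn (S k) f) : PT f := by
  have sub : ∀ k, {p : γ × α | (enc p).snd.fst = Data.unary k} ∩ {p | ∃ k < 5, p ∈ S k} ⊆ S k := by
    rintro k p ⟨h1, j, -, h2⟩
    have h3 := hk j p h2
    rw [Set.mem_ofPred_eq, h3] at h1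
    have : j = k := by
      have := congrArg (fun d : Data => d.size) h1
      have key : ∀ n : ℕ, (Data.unary n).size = 2 * n + 1 := by
        intro n
        induction n with
        | zero => rfl
        | succ n ih => simp [Data.unary, List.replicate_succ, Data.ofList, Data.size] at ih ⊢; omega
      simp only [key] at this
      omega
    exact this ▸ h2
  have tagged : ∀ k < 5, PTOn {p : γ × α | (enc p).snd.fst = Data.unary k} f := fun k hk' =>
    (h k hk').mono fun p hp => sub k ⟨hp, hS p⟩
  have tail : ∀ d : Data, ∀ k, d.snd = Data.unary (k + 1) → d.snd.snd = Data.unary k := by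
    intro d k h; rw [h]; rfl
  have nonnil : ∀ k, Data.unary (k + 1) ≠ .nil := by intro k h; cases h
  -- The tag is a unary number at the front of the second component. Testing successive tails of it
  -- for `nil` decides whether it is 0, 1, 2, 3 or 4.
  have T0 : PT fun d : Data => d.snd.fst := .data_fst (.data_snd .id)
  have T1 := T0.data_snd
  have T2 := T1.data_snd
  have T3 := T2.data_snd
  refine ptOn_univ.1 (PTOn.branch T0 ((tagged 0 (by simp)).mono ?_) (PTOn.branch T1
    ((tagged 1 (by simp)).mono ?_) (PTOn.branch T2 ((tagged 2 (by simp)).mono ?_) (PTOn.branch T3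
    ((tagged 3 (by simp)).mono ?_) ((tagged 4 (by simp)).mono ?_)))))
  all_goals
    intro p hp
    obtain ⟨k, hk5, hpk⟩ := hS p
    have hk' := hk k p hpk
    simp only [Set.mem_inter_iff, Set.mem_ofPred_eq, Set.mem_univ, true_and, hk'] at hp ⊢
    interval_cases k <;> simp_all [Data.unary, List.replicate_succ, Data.ofList, Data.snd]

/-- Keeps the context in the first component and strips the constructor tag from the second. -/
theorem pt_untag : PT fun d : Data => Data.cons d.fst d.snd.snd :=
  .data_cons (.data_fst .id) (.data_snd (.data_snd .id))

theorem PT.formula_cases {f : γ → Formula → β}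
    (h0 : PT fun p : γ × PredName × List Term => f p.1 (.atom p.2.1 p.2.2))
    (h1 : PT fun p : γ × Formula => f p.1 (.neg p.2))
    (h2 : PT fun p : γ × Formula × Formula => f p.1 (.and p.2.1 p.2.2))
    (h3 : PT fun p : γ × List Bool × Formula => f p.1 (.all p.2.1 p.2.2))
    (h4 : PT fun p : γ × StExpr × Formula => f p.1 (.box p.2.1 p.2.2)) :
    PT fun p : γ × Formula => f p.1 p.2 := by
  refine PT.of_tags (S := fun k => {p | k = p.2.casesOn (fun _ _ => 0) (fun _ => 1)
    (fun _ _ => 2) (fun _ _ => 3) (fun _ _ => 4)}) ?_ ?_ ?_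
  · rintro ⟨c, φ⟩
    cases φ <;> simp
  · rintro k ⟨c, φ⟩ hk
    cases φ <;> (simp only [Set.mem_ofPred_eq] at hk; subst hk; rfl)
  · intro k hk
    interval_cases k
    · refine PTOn.of_view pt_untag h0 ?_
      rintro ⟨c, φ⟩ h
      cases φ <;> simp at h
      exact ⟨(c, _, _), rfl, rfl⟩
    · refine PTOn.of_view pt_untag h1 ?_
      rintro ⟨c, φ⟩ h
      cases φ <;> simp at h
      rename_i φ
      exact ⟨(c, φ), rfl, rfl⟩
    · refine PTOn.of_view pt_untag h2 ?_
      rintro ⟨c, φ⟩ h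
      cases φ <;> simp at h
      exact ⟨(c, _, _), rfl, rfl⟩
    · refine PTOn.of_view pt_untag h3 ?_
      rintro ⟨c, φ⟩ h
      cases φ <;> simp at h
      exact ⟨(c, _, _), rfl, rfl⟩
    · refine PTOn.of_view pt_untag h4 ?_
      rintro ⟨c, φ⟩ h
      cases φ <;> simp at h
      exact ⟨(c, _, _), rfl, rfl⟩

theorem PT.expr_cases {f : γ → StExpr → β}
    (h0 : PT fun c => f c .all)
    (h1 : PT fun p : γ × List Bool => f p.1 (.symb p.2))
    (h2 : PT fun p : γ × StExpr × StExpr => f p.1 (.union p.2.1 p.2.2))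
    (h3 : PT fun p : γ × StExpr × StExpr => f p.1 (.inter p.2.1 p.2.2))
    (h4 : PT fun p : γ × StExpr × StExpr => f p.1 (.diff p.2.1 p.2.2)) :
    PT fun p : γ × StExpr => f p.1 p.2 := by
  refine PT.of_tags (S := fun k => {p | k = p.2.casesOn 0 (fun _ => 1)
    (fun _ _ => 2) (fun _ _ => 3) (fun _ _ => 4)}) ?_ ?_ ?_
  · rintro ⟨c, φ⟩
    cases φ <;> simp
  · rintro k ⟨c, φ⟩ hk
    cases φ <;> (simp only [Set.mem_ofPred_eq] at hk; subst hk; rfl)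
  · intro k hk
    interval_cases k
    · refine PTOn.of_view (.data_fst .id) h0 ?_
      rintro ⟨c, φ⟩ h
      cases φ <;> simp at h
      exact ⟨c, rfl, rfl⟩
    · refine PTOn.of_view pt_untag h1 ?_
      rintro ⟨c, φ⟩ h
      cases φ <;> simp at h
      exact ⟨(c, _), rfl, rfl⟩
    · refine PTOn.of_view pt_untag h2 ?_
      rintro ⟨c, φ⟩ h
      cases φ <;> simp at h
      exact ⟨(c, _, _), rfl, rfl⟩
    · refine PTOn.of_view pt_untag h3 ?_
      rintro ⟨c, φ⟩ h
      cases φ <;> simp at h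
      exact ⟨(c, _, _), rfl, rfl⟩
    · refine PTOn.of_view pt_untag h4 ?_
      rintro ⟨c, φ⟩ h
      cases φ <;> simp at h
      exact ⟨(c, _, _), rfl, rfl⟩

theorem PT.stack_one {f : γ → β → β} (hf : PT fun p : γ × β => f p.1 p.2) :
    PT fun p : γ × List β => (p.2.casesOn [] fun u s => f p.1 u :: s : List β) := by
  refine PT.list_cases (f := fun c (s : List β) =>
    (s.casesOn [] fun u s => f c u :: s : List β)) (.const _) ?_
  have := PT.comp hf (f := fun p : γ × β × List β => (p.1, p.2.1)) (by fun_prop)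
  fun_prop

theorem PT.stack_two {f : γ → β → β → β} (hf : PT fun p : γ × β × β => f p.1 p.2.1 p.2.2) :
    PT fun p : γ × List β => (p.2.casesOn [] fun u s => s.casesOn [] fun v s => f p.1 u v :: s :
      List β) := by
  refine PT.list_cases (f := fun c (s : List β) =>
    (s.casesOn [] fun u s => s.casesOn [] fun v s => f c u v :: s : List β)) (.const _) ?_
  have h := PT.list_cases (γ := γ × β) (f := fun (c : γ × β) (s : List β) =>
    (s.casesOn [] fun v s => f c.1 c.2 v :: s : List β)) (.const _) (by
      have := PT.comp hf (f := fun p : (γ × β) × β × List β => (p.1.1, p.1.2, p.2.1)) (by fun_prop)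
      fun_prop)
  exact PT.comp h (f := fun p : γ × β × List β => ((p.1, p.2.1), p.2.2)) (by fun_prop)

theorem treeView_expr : TreeView (fun e : StExpr => e.casesOn [] (fun _ => [])
    (fun e f => [e, f]) (fun e f => [e, f]) (fun e f => [e, f])) sz where
  push := by
    have := PT.expr_cases (γ := List StExpr) (f := fun c e => (e.casesOn [] (fun _ => [])
      (fun e f => [e, f]) (fun e f => [e, f]) (fun e f => [e, f]) : List StExpr) ++ c)
      (by simp; fun_prop) (by simp; fun_prop) (by simp; fun_prop) (by simp; fun_prop)
      (by simp; fun_prop)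
    exact PT.comp this (f := fun p : StExpr × List StExpr => (p.2, p.1)) (by fun_prop)
  lt e := by cases e <;> simp [sz_pos]
  sz_le e := by cases e <;> simp <;> omega
  m_le _ := le_rfl

theorem treeView_formula : TreeView (fun φ : Formula => φ.casesOn (fun _ _ => []) (fun φ => [φ])
    (fun φ ψ => [φ, ψ]) (fun _ φ => [φ]) (fun _ φ => [φ])) sz where
  push := by
    have := PT.formula_cases (γ := List Formula) (f := fun c φ => (φ.casesOn (fun _ _ => [])
      (fun φ => [φ]) (fun φ ψ => [φ, ψ]) (fun _ φ => [φ]) (fun _ φ => [φ]) : List Formula) ++ c)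
      (by simp; fun_prop) (by simp; fun_prop) (by simp; fun_prop) (by simp; fun_prop)
      (by simp; fun_prop)
    exact PT.comp this (f := fun p : Formula × List Formula => (p.2, p.1)) (by fun_prop)
  lt e := by cases e <;> simp <;> omega
  sz_le e := by cases e <;> simp <;> omega
  m_le _ := le_rfl

/-- The instance of tree recursion used for all syntactic functions below. The context is fixed
throughout, so parameters that change along the recursion have to be handled differently. -/
theorem PT.formula_rec {V : γ → Formula → β} {f1 : γ → Formula → β → β}
    {f2 : γ → Formula × Formula → β → β → β} {f3 : γ → List Bool × Formula → β → β}
    {f4 : γ → StExpr × Formula → β → β}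
    (h0 : PT fun p : γ × PredName × List Term => V p.1 (.atom p.2.1 p.2.2))
    (h1 : PT fun p : (γ × Formula) × β => f1 p.1.1 p.1.2 p.2)
    (h2 : PT fun p : (γ × Formula × Formula) × β × β => f2 p.1.1 p.1.2 p.2.1 p.2.2)
    (h3 : PT fun p : (γ × List Bool × Formula) × β => f3 p.1.1 p.1.2 p.2)
    (h4 : PT fun p : (γ × StExpr × Formula) × β => f4 p.1.1 p.1.2 p.2)
    (hV : ∀ c, (∀ φ, V c (.neg φ) = f1 c φ (V c φ)) ∧
      (∀ φ ψ, V c (.and φ ψ) = f2 c (φ, ψ) (V c φ) (V c ψ)) ∧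
      (∀ x φ, V c (.all x φ) = f3 c (x, φ) (V c φ)) ∧
      (∀ e φ, V c (.box e φ) = f4 c (e, φ) (V c φ))) (q : Polynomial ℕ)
    (hq : ∀ c, (∀ φ, sz (V c (.neg φ)) ≤ sz (V c φ) + q.eval (sz c + sz φ.neg)) ∧
      (∀ φ ψ, sz (V c (.and φ ψ)) ≤ sz (V c φ) + sz (V c ψ) + q.eval (sz c + sz (φ.and ψ))) ∧
      (∀ x φ, sz (V c (.all x φ)) ≤ sz (V c φ) + q.eval (sz c + sz (φ.all x))) ∧
      (∀ e φ, sz (V c (.box e φ)) ≤ sz (V c φ) + q.eval (sz c + sz (φ.box e)))) :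
    PT fun p : γ × Formula => V p.1 p.2 := by
  obtain ⟨q0, hq0⟩ := h0.sz_le
  refine treeView_formula.pt_rec (K := fun c x (s : List β) =>
    x.casesOn (fun P ts => V c (.atom P ts) :: s)
      (fun φ => s.casesOn [] fun u s => f1 c φ u :: s)
      (fun φ ψ => s.casesOn [] fun u s => s.casesOn [] fun v s => f2 c (φ, ψ) u v :: s)
      (fun x φ => s.casesOn [] fun u s => f3 c (x, φ) u :: s)
      (fun e φ => s.casesOn [] fun u s => f4 c (e, φ) u :: s)) ?_ ?_ (q + q0) ?_
  · have g1 := PT.stack_one (γ := γ × Formula) (f := fun c u => f1 c.1 c.2 u) h1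
    have g2 := PT.stack_two (γ := γ × Formula × Formula) (f := fun c u => f2 c.1 c.2 u) h2
    have g3 := PT.stack_one (γ := γ × List Bool × Formula) (f := fun c u => f3 c.1 c.2 u) h3
    have g4 := PT.stack_one (γ := γ × StExpr × Formula) (f := fun c u => f4 c.1 c.2 u) h4
    have h := PT.formula_cases (γ := γ × List β) (f := fun c x =>
      (x.casesOn (fun P ts => V c.1 (.atom P ts) :: c.2)
        (fun φ => c.2.casesOn [] fun u s => f1 c.1 φ u :: s)
        (fun φ ψ => c.2.casesOn [] fun u s => s.casesOn [] fun v s => f2 c.1 (φ, ψ) u v :: s)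
        (fun x φ => c.2.casesOn [] fun u s => f3 c.1 (x, φ) u :: s)
        (fun e φ => c.2.casesOn [] fun u s => f4 c.1 (e, φ) u :: s) : List β))
      (by
        have := PT.comp h0 (f := fun p : (γ × List β) × PredName × List Term => (p.1.1, p.2))
          (by fun_prop)
        exact PT.list_cons this (by fun_prop))
      (PT.comp g1 (f := fun p : (γ × List β) × Formula => ((p.1.1, p.2), p.1.2)) (by fun_prop))
      (PT.comp g2 (f := fun p : (γ × List β) × Formula × Formula => ((p.1.1, p.2), p.1.2))
        (by fun_prop))
      (PT.comp g3 (f := fun p : (γ × List β) × List Bool × Formula => ((p.1.1, p.2), p.1.2))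
        (by fun_prop))
      (PT.comp g4 (f := fun p : (γ × List β) × StExpr × Formula => ((p.1.1, p.2), p.1.2))
        (by fun_prop))
    exact PT.comp h (f := fun p : γ × Formula × List β => ((p.1, p.2.2), p.2.1)) (by fun_prop)
  · intro c x s
    cases x <;> simp [hV]
  · intro c x
    obtain ⟨e1, e2, e3, e4⟩ := hq c
    rw [Polynomial.eval_add]
    cases x with
    | atom P ts =>
      have := hq0 (c, P, ts)
      have := eval_mono q0 (show sz (c, P, ts) ≤ sz c + sz (Formula.atom P ts) by simp)
      simp at *; omega
    | neg φ => have := e1 φ; simp at *; omega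
    | and φ ψ => have := e2 φ ψ; simp at *; omega
    | all x φ => have := e3 x φ; simp at *; omega
    | box e φ => have := e4 e φ; simp at *; omega
end

/-! ### Equality of formulas -/

theorem unary_injective : Function.Injective Data.unary := by
  intro m
  induction m with
  | zero => intro n h; cases n <;> [rfl; cases h]
  | succ m ih =>
    intro n h
    cases n with
    | zero => cases h
    | succ n => injection h with _ h; exact congrArg _ (ih h)

theorem ofList_injective : Function.Injective Data.ofList := by
  intro l
  induction l with
  | nil => intro l' h; cases l' <;> [rfl; cases h]
  | cons a l ih =>
    intro l' h
    cases l' with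
    | nil => cases h
    | cons b l' => injection h with h1 h2; rw [h1, ih h2]

theorem word_injective : Function.Injective Data.word := by
  intro u v h
  refine List.map_injective_iff.2 ?_ (ofList_injective h)
  intro a b
  cases a <;> cases b <;> simp

theorem tag_inj {m n : ℕ} {d e : Data} : Data.tag m d = Data.tag n e ↔ m = n ∧ d = e := by
  simp [Data.tag, unary_injective.eq_iff]

theorem PredName.code_injective : Function.Injective PredName.code := by
  intro P
  induction P with
  | base w =>
    rintro (w' | ⟨Q, i⟩ | ⟨_ | s, i⟩) h <;> simp [PredName.code, tag_inj] at h
    rw [word_injective h]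
  | copy P i ih =>
    rintro (w' | ⟨Q, j⟩ | ⟨_ | s, j⟩) h <;> simp [PredName.code, tag_inj] at h
    rw [ih h.1, unary_injective h.2]
  | stand s i =>
    rcases s with _ | s <;> rintro (w' | ⟨Q, j⟩ | ⟨_ | s', j⟩) h <;>
      simp [PredName.code, tag_inj] at h
    · rw [unary_injective h]
    · rw [word_injective h.1, unary_injective h.2]

theorem Term.code_injective : Function.Injective Term.code := by
  rintro (x | x) (y | y) h <;> simp [Term.code, tag_inj] at h <;> rw [word_injective h]

theorem StExpr.code_injective : Function.Injective StExpr.code := by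
  intro e
  induction e with
  | all => rintro (_ | _ | _ | _ | _) h <;> simp [StExpr.code, tag_inj] at h; rfl
  | symb s =>
    rintro (_ | _ | _ | _ | _) h <;> simp [StExpr.code, tag_inj] at h
    rw [word_injective h]
  | union e f ihe ihf | inter e f ihe ihf | diff e f ihe ihf =>
    rintro (_ | _ | _ | _ | _) h <;> simp [StExpr.code, tag_inj] at h
    rw [ihe h.1, ihf h.2]

/-- Reduces equality of formulas to equality of trees, as needed to count distinct subformulas and
to find the index of a modal subformula. -/
theorem Formula.code_injective : Function.Injective Formula.code := by
  intro φ
  induction φ with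
  | atom P ts =>
    rintro (_ | _ | _ | _ | _) h <;> simp [Formula.code, tag_inj] at h
    rw [PredName.code_injective h.1,
      List.map_injective_iff.2 Term.code_injective (ofList_injective h.2)]
  | neg φ ih =>
    rintro (_ | _ | _ | _ | _) h <;> simp [Formula.code, tag_inj] at h
    rw [ih h]
  | and φ ψ ih ih' =>
    rintro (_ | _ | _ | _ | _) h <;> simp [Formula.code, tag_inj] at h
    rw [ih h.1, ih' h.2]
  | all x φ ih =>
    rintro (_ | _ | _ | _ | _) h <;> simp [Formula.code, tag_inj] at h
    rw [word_injective h.1, ih h.2]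
  | box e φ ih =>
    rintro (_ | _ | _ | _ | _) h <;> simp [Formula.code, tag_inj] at h
    rw [StExpr.code_injective h.1, ih h.2]

instance : EqPT Formula := .of_injective Formula.code_injective

/-! ### Size and labels -/

section
variable {γ : Type} [Enc γ]

/-- The occurrences of subformulas. -/
def Formula.occurrences : Formula → List Formula
  | atom P ts => [atom P ts]
  | neg φ => neg φ :: φ.occurrences
  | and φ ψ => and φ ψ :: (φ.occurrences ++ ψ.occurrences)
  | all x φ => all x φ :: φ.occurrences
  | box e φ => box e φ :: φ.occurrences

theorem Formula.toFinset_occurrences (φ : Formula) : φ.occurrences.toFinset = φ.sub := by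
  induction φ <;> simp_all [Formula.occurrences, Formula.sub]

theorem pt_occurrences : PT Formula.occurrences := by
  have := PT.formula_rec (γ := Bool) (V := fun _ φ => φ.occurrences)
    (f1 := fun _ φ v => φ.neg :: v) (f2 := fun _ p u v => .and p.1 p.2 :: (u ++ v))
    (f3 := fun _ p v => .all p.1 p.2 :: v) (f4 := fun _ p v => .box p.1 p.2 :: v)
    (by simp only [Formula.occurrences]; fun_prop) (by fun_prop) (by fun_prop) (by fun_prop)
    (by fun_prop) (by simp [Formula.occurrences]) (.X + 1) (by
      intro c
      refine ⟨?_, ?_, ?_, ?_⟩ <;> intros <;> simp [Formula.occurrences]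
      · omega
      · rename_i φ ψ
        have := sz_append φ.occurrences ψ.occurrences
        omega
      all_goals omega)
  exact PT.comp this (f := fun φ => (true, φ)) (by fun_prop)

@[fun_prop]
theorem PT.formula_size {f : γ → Formula} (hf : PT f) : PT fun c => (f c).size := by
  have : ∀ φ : Formula, φ.size = φ.occurrences.dedup.length := fun φ => by
    rw [Formula.size, ← φ.toFinset_occurrences, List.card_toFinset]
  simp only [this]
  have := PT.comp pt_occurrences hf
  fun_prop

theorem pt_boxes : PT Formula.boxes := by
  have := PT.formula_rec (γ := Bool) (V := fun _ φ => φ.boxes)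
    (f1 := fun _ φ v => v) (f2 := fun _ p u v => u ++ v)
    (f3 := fun _ p v => v) (f4 := fun _ p v => .box p.1 p.2 :: v)
    (by simp only [Formula.boxes]; fun_prop) (by fun_prop) (by fun_prop) (by fun_prop)
    (by fun_prop) (by simp [Formula.boxes]) (.X + 1) (by
      intro c
      refine ⟨?_, ?_, ?_, ?_⟩ <;> intros <;> simp [Formula.boxes]
      · rename_i φ ψ
        have := sz_append φ.boxes ψ.boxes
        omega
      all_goals omega)
  exact PT.comp this (f := fun φ => (true, φ)) (by fun_prop)

/-- The label of a closed modal subformula. -/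
def Formula.closedLabel (φ ψ : Formula) : Formula :=
  .atom (.base (List.replicate (φ.code.size + φ.boxes.idxOf ψ) true)) []

@[fun_prop]
theorem PT.closedLabel {f g : γ → Formula} (hf : PT f) (hg : PT g) :
    PT fun c => (f c).closedLabel (g c) := by
  have h1 : PT fun c => (f c).code.size := PT.comp pt_data_size hf.to_enc
  have h2 := PT.comp pt_boxes hf
  unfold Formula.closedLabel
  fun_prop

/-- In a sentential formula all modal subformulas are closed. Labels then have no arguments and
their definitions no quantifiers, so the programs need not compute free variables. -/
theorem Formula.label_eq {φ ψ : Formula} (h : ψ.Closed) : φ.label ψ = φ.closedLabel ψ := by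
  simp only [Formula.label, Formula.closedLabel]
  rw [h]
  rfl

/-! ### The normal form of sentential formulas -/

/-- Agrees with `Formula.flatten` on sentential formulas, by `Formula.flatten_eq`. -/
def Formula.closedFlatten (φ : Formula) : Formula → Formula
  | atom P ts => atom P ts
  | neg ψ => neg (Formula.closedFlatten φ ψ)
  | and ψ χ => and (Formula.closedFlatten φ ψ) (Formula.closedFlatten φ χ)
  | all x ψ => all x (Formula.closedFlatten φ ψ)
  | box e ψ => φ.closedLabel (box e ψ)

@[fun_prop]
theorem PT.closedFlatten {f g : γ → Formula} (hf : PT f) (hg : PT g) :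
    PT fun c => (f c).closedFlatten (g c) := by
  have hl : PT fun p : (Formula × StExpr × Formula) =>
    p.1.closedLabel (.box p.2.1 p.2.2) := by fun_prop
  obtain ⟨q, hq⟩ := hl.sz_le
  have := PT.formula_rec (V := Formula.closedFlatten)
    (f1 := fun _ _ v => v.neg) (f2 := fun _ _ u v => .and u v)
    (f3 := fun _ p v => .all p.1 v) (f4 := fun φ p _ => φ.closedLabel (.box p.1 p.2))
    (by simp only [Formula.closedFlatten]; fun_prop) (by fun_prop) (by fun_prop) (by fun_prop)
    (by fun_prop) (by simp [Formula.closedFlatten]) (q + .X + 10) (by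
      intro c
      refine ⟨?_, ?_, ?_, ?_⟩ <;> intros <;> simp [Formula.closedFlatten]
      · omega
      · rename_i e φ
        have h1 := hq (c, e, φ)
        have h2 := eval_mono q (show sz (c, e, φ) ≤ sz c + sz (φ.box e) by simp)
        simp at *
        omega)
  exact PT.comp this (f := fun c => (f c, g c)) (by fun_prop)

def Formula.closedFlattenNested (φ : Formula) : Formula → Formula
  | atom P ts => atom P ts
  | neg ψ => neg (Formula.closedFlattenNested φ ψ)
  | and ψ χ => and (Formula.closedFlattenNested φ ψ) (Formula.closedFlattenNested φ χ)
  | all x ψ => all x (Formula.closedFlattenNested φ ψ)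
  | box e ψ => box e (Formula.closedFlatten φ ψ)

@[fun_prop]
theorem PT.closedFlattenNested {f g : γ → Formula} (hf : PT f) (hg : PT g) :
    PT fun c => (f c).closedFlattenNested (g c) := by
  have hl : PT fun p : Formula × Formula => p.1.closedFlatten p.2 := by fun_prop
  obtain ⟨q, hq⟩ := hl.sz_le
  have := PT.formula_rec (V := Formula.closedFlattenNested)
    (f1 := fun _ _ v => v.neg) (f2 := fun _ _ u v => .and u v)
    (f3 := fun _ p v => .all p.1 v) (f4 := fun φ p _ => .box p.1 (φ.closedFlatten p.2))
    (by simp only [Formula.closedFlattenNested]; fun_prop) (by fun_prop) (by fun_prop)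
    (by fun_prop) (by fun_prop) (by simp [Formula.closedFlattenNested]) (q + .X + 11) (by
      intro c
      refine ⟨?_, ?_, ?_, ?_⟩ <;> intros <;> simp [Formula.closedFlattenNested]
      · omega
      · rename_i e φ
        have h1 := hq (c, φ)
        have h2 := eval_mono q (show sz (c, φ) ≤ sz c + sz (φ.box e) by simp; omega)
        simp at *
        omega)
  exact PT.comp this (f := fun c => (f c, g c)) (by fun_prop)

/-- The definition that is contributed by an occurrence of a closed subformula. -/
def Formula.localDefinition (φ : Formula) (pos nested : Bool) : Formula → List Formula
  | box e ψ =>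
      bif nested then
        [bif pos then (φ.closedLabel (box e ψ)).imp (box e (Formula.closedFlatten φ ψ))
          else (box e (Formula.closedFlatten φ ψ)).imp (φ.closedLabel (box e ψ))]
      else []
  | _ => []

theorem pt_localDefinition :
    PT fun p : Formula × Bool × Bool × Formula => p.1.localDefinition p.2.1 p.2.2.1 p.2.2.2 := by
  have := PT.formula_cases (γ := Formula × Bool × Bool)
    (f := fun c ψ => c.1.localDefinition c.2.1 c.2.2 ψ)
    (by simp only [Formula.localDefinition]; fun_prop)
    (by simp only [Formula.localDefinition]; fun_prop)
    (by simp only [Formula.localDefinition]; fun_prop)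
    (by simp only [Formula.localDefinition]; fun_prop)
    (by simp only [Formula.localDefinition]; fun_prop)
  exact PT.comp this (f := fun p : Formula × Bool × Bool × Formula =>
    ((p.1, p.2.1, p.2.2.1), p.2.2.2)) (by fun_prop)

/-- The occurrences of subformulas together with their polarity and the information whether they
are in the scope of a modal operator. -/
def Formula.nodes : Bool × Bool × Formula → List (Bool × Bool × Formula)
  | (pos, nested, atom P ts) => [(pos, nested, atom P ts)]
  | (pos, nested, neg φ) => (pos, nested, neg φ) :: Formula.nodes (!pos, nested, φ)
  | (pos, nested, and φ ψ) =>
      (pos, nested, and φ ψ) :: (Formula.nodes (pos, nested, φ) ++ Formula.nodes (pos, nested, ψ))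
  | (pos, nested, all x φ) => (pos, nested, all x φ) :: Formula.nodes (pos, nested, φ)
  | (pos, nested, box e φ) => (pos, nested, box e φ) :: Formula.nodes (pos, true, φ)

/-- Only the formula is counted in the weight, because the flags may grow: flipping the polarity or
entering a modal operator adds at most 2 to the size of a node, while the formula loses at least 4.
-/
theorem treeView_node : TreeView (fun p : Bool × Bool × Formula => p.2.2.casesOn (fun _ _ => [])
    (fun φ => [(bif p.1 then false else true, p.2.1, φ)])
    (fun φ ψ => [(p.1, p.2.1, φ), (p.1, p.2.1, ψ)])
    (fun _ φ => [(p.1, p.2.1, φ)]) (fun _ φ => [(p.1, true, φ)])) (fun p => sz p.2.2) where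
  push := by
    have := PT.formula_cases (γ := (Bool × Bool) × List (Bool × Bool × Formula)) (f := fun c φ =>
      (φ.casesOn (fun _ _ => [])
        (fun φ => [(bif c.1.1 then false else true, c.1.2, φ)])
        (fun φ ψ => [(c.1.1, c.1.2, φ), (c.1.1, c.1.2, ψ)])
        (fun _ φ => [(c.1.1, c.1.2, φ)])
        (fun _ φ => [(c.1.1, true, φ)]) : List (Bool × Bool × Formula)) ++ c.2)
      (by simp only; fun_prop) (by simp only; fun_prop) (by simp only; fun_prop)
      (by simp only; fun_prop) (by simp only; fun_prop)
    exact PT.comp this (f := fun p : (Bool × Bool × Formula) × List (Bool × Bool × Formula) =>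
      (((p.1.1, p.1.2.1), p.2), p.1.2.2)) (by fun_prop)
  lt := by
    rintro ⟨a, b, φ⟩
    cases φ <;> simp [sz_pos] <;> omega
  sz_le := by
    rintro ⟨a, b, φ⟩
    have := sz_bool_le (!a)
    have := sz_pos a
    have := sz_pos b
    cases φ <;> simp at * <;> omega
  m_le := by
    rintro ⟨a, b, φ⟩
    simp
    omega

theorem pt_nodes : PT Formula.nodes := by
  refine treeView_node.pt_preorder ?_
  rintro ⟨a, b, φ⟩
  cases φ <;> simp [Formula.nodes]

theorem Formula.Sentential.neg {φ : Formula} (h : φ.neg.Sentential) : φ.Sentential :=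
  fun e ψ hψ => h e ψ (by simp [Formula.sub, hψ])

theorem Formula.Sentential.and_left {φ ψ : Formula} (h : (φ.and ψ).Sentential) : φ.Sentential :=
  fun e ψ hψ => h e ψ (by simp [Formula.sub, hψ])

theorem Formula.Sentential.and_right {φ ψ : Formula} (h : (φ.and ψ).Sentential) : ψ.Sentential :=
  fun e ψ hψ => h e ψ (by simp [Formula.sub, hψ])

theorem Formula.Sentential.all {x : Ident} {φ : Formula} (h : (φ.all x).Sentential) :
    φ.Sentential :=
  fun e ψ hψ => h e ψ (by simp [Formula.sub, hψ])

theorem Formula.Sentential.box {e : StExpr} {φ : Formula} (h : (φ.box e).Sentential) :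
    φ.Sentential :=
  fun e ψ hψ => h e ψ (by simp [Formula.sub, hψ])

theorem Formula.Sentential.closed {e : StExpr} {φ : Formula} (h : (φ.box e).Sentential) :
    φ.Closed := h e φ (by simp [Formula.sub])

theorem Formula.flatten_eq (φ : Formula) {ψ : Formula} (h : ψ.Sentential) :
    φ.flatten ψ = φ.closedFlatten ψ := by
  induction ψ with
  | atom P ts => rfl
  | neg ψ ih => simp [Formula.flatten, Formula.closedFlatten, ih h.neg]
  | and ψ χ ih ih' =>
    simp [Formula.flatten, Formula.closedFlatten, ih h.and_left, ih' h.and_right]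
  | all x ψ ih => simp [Formula.flatten, Formula.closedFlatten, ih h.all]
  | box e ψ ih => exact Formula.label_eq h.closed

theorem Formula.flattenNested_eq (φ : Formula) {ψ : Formula} (h : ψ.Sentential) :
    φ.flattenNested ψ = φ.closedFlattenNested ψ := by
  induction ψ with
  | atom P ts => rfl
  | neg ψ ih => simp [Formula.flattenNested, Formula.closedFlattenNested, ih h.neg]
  | and ψ χ ih ih' =>
    simp [Formula.flattenNested, Formula.closedFlattenNested, ih h.and_left, ih' h.and_right]
  | all x ψ ih => simp [Formula.flattenNested, Formula.closedFlattenNested, ih h.all]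
  | box e ψ ih =>
    simp [Formula.flattenNested, Formula.closedFlattenNested, φ.flatten_eq h.box]

/-- The recursion defining the left side changes its flags on the way down. Listing the nodes with
their flags beforehand turns it into independent local contributions. -/
theorem Formula.definitions_eq (φ : Formula) {ψ : Formula} (h : ψ.Sentential) (pos nested : Bool) :
    φ.definitions pos nested ψ = (Formula.nodes (pos, nested, ψ)).flatMap
      fun p => φ.localDefinition p.1 p.2.1 p.2.2 := by
  induction ψ generalizing pos nested with
  | atom P ts => simp [Formula.definitions, Formula.nodes, Formula.localDefinition]
  | neg ψ ih =>
    simp [Formula.definitions, Formula.nodes, Formula.localDefinition, ih h.neg]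
  | and ψ χ ih ih' =>
    simp [Formula.definitions, Formula.nodes, Formula.localDefinition, ih h.and_left,
      ih' h.and_right]
  | all x ψ ih =>
    simp [Formula.definitions, Formula.nodes, Formula.localDefinition, ih h.all]
  | box e ψ ih =>
    have hc : ψ.freeVars = [] := h.closed
    have hb : (Formula.box e ψ).Closed := h.closed
    cases pos <;> cases nested <;>
      simp [Formula.definitions, Formula.nodes, Formula.localDefinition, ih h.box, hc,
        Formula.alls, Formula.label_eq hb, φ.flatten_eq h.box]

def Formula.closedSsnf (φ : Formula) : Formula :=
  ((Formula.nodes (true, false, φ)).flatMap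
      fun p => φ.localDefinition p.1 p.2.1 p.2.2).foldl
    Formula.and (φ.closedFlattenNested φ)

theorem Formula.ssnf_eq {φ : Formula} (h : φ.Sentential) : φ.ssnf = φ.closedSsnf := by
  rw [Formula.ssnf, Formula.closedSsnf, φ.flattenNested_eq h, φ.definitions_eq h]

theorem pt_closedSsnf : PT Formula.closedSsnf := by
  have h1 : PT fun φ : Formula => Formula.nodes (true, false, φ) :=
    PT.comp pt_nodes (by fun_prop)
  have h2 := pt_localDefinition
  have h3 := PT.flatMap (f := fun (φ : Formula) p => φ.localDefinition p.1 p.2.1 p.2.2) h1 h2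
  refine PT.foldl_add (f := fun (_ : Formula) => Formula.and) h3 (by fun_prop) (by fun_prop)
    (.X + 7) ?_
  intro c b a
  simp
  omega

/-! ### The translation -/

theorem pt_conj : PT FOFormula.conj := by
  let taut : FOFormula := .neg (.and (.atom (.stand none 0) []) (.neg (.atom (.stand none 0) [])))
  have key : ∀ (a : FOFormula) l,
      FOFormula.conj (a :: l) = bif decide (l.length = 0) then a else .and a (.conj l) := by
    intro a l
    cases l <;> simp [FOFormula.conj]
  have hz : PT fun n : ℕ => decide (n = 0) := by
    have := PT.nat_cases (γ := Bool) (f := fun _ n => decide (n = 0)) (by simp; fun_prop)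
      (by simp; fun_prop)
    exact PT.comp this (f := fun n => (true, n)) (by fun_prop)
  have := PT.list_rec (γ := Bool) (V := fun _ l => FOFormula.conj l)
    (f := fun _ a l v => bif decide (l.length = 0) then a else .and a v) (by fun_prop)
    (by
      have := PT.comp hz (f := fun p : Bool × FOFormula × List FOFormula × FOFormula =>
        p.2.2.1.length) (by fun_prop)
      fun_prop) (by simp [key]) (.X + 7) (by
      intro c a l
      rw [key]
      by_cases h : l = [] <;> simp [h] <;> omega)
  exact PT.comp this (f := fun l => (true, l)) (by fun_prop)

@[fun_prop]
theorem PT.conj {f : γ → List FOFormula} (hf : PT f) : PT fun c => FOFormula.conj (f c) :=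
  PT.comp pt_conj hf

@[fun_prop]
theorem PT.expr_trans {f : γ → ℕ} {g : γ → StExpr} (hf : PT f) (hg : PT g) :
    PT fun c => (g c).trans (f c) := by
  have h0 : PT fun i => StExpr.trans i .all := by simp only [StExpr.trans]; fun_prop
  have h1 : PT fun p : ℕ × List Bool => StExpr.trans p.1 (.symb p.2) := by
    simp only [StExpr.trans]; fun_prop
  obtain ⟨q0, hq0⟩ := h0.sz_le
  obtain ⟨q1, hq1⟩ := h1.sz_le
  have h := treeView_expr.pt_rec (γ := ℕ) (V := fun i e => e.trans i)
    (K := fun c x s => x.casesOn (StExpr.trans c .all :: s) (fun w => StExpr.trans c (.symb w) :: s)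
      (fun _ _ => s.casesOn [] fun u s => s.casesOn [] fun v s => .or u v :: s)
      (fun _ _ => s.casesOn [] fun u s => s.casesOn [] fun v s => .and u v :: s)
      (fun _ _ => s.casesOn [] fun u s => s.casesOn [] fun v s => .and u (.neg v) :: s))
    ?_ ?_ (q0 + q1 + 20) ?_
  · exact PT.comp h (f := fun c => (f c, g c)) (by fun_prop)
  · have g2 := PT.stack_two (γ := Bool) (f := fun _ => FOFormula.or) (by fun_prop)
    have g3 := PT.stack_two (γ := Bool) (f := fun _ => FOFormula.and) (by fun_prop)
    have g4 := PT.stack_two (γ := Bool) (f := fun _ u v => FOFormula.and u (.neg v)) (by fun_prop)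
    have h := PT.expr_cases (γ := ℕ × List FOFormula) (f := fun c x =>
      (x.casesOn (StExpr.trans c.1 .all :: c.2) (fun w => StExpr.trans c.1 (.symb w) :: c.2)
        (fun _ _ => c.2.casesOn [] fun u s => s.casesOn [] fun v s => .or u v :: s)
        (fun _ _ => c.2.casesOn [] fun u s => s.casesOn [] fun v s => .and u v :: s)
        (fun _ _ => c.2.casesOn [] fun u s => s.casesOn [] fun v s => .and u (.neg v) :: s) :
        List FOFormula))
      (PT.list_cons (PT.comp h0 (PT.fst .id)) (by fun_prop))
      (PT.list_cons (PT.comp h1 (f := fun p : (ℕ × List FOFormula) × List Bool => (p.1.1, p.2))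
        (by fun_prop)) (by fun_prop))
      (PT.comp g2 (f := fun p : (ℕ × List FOFormula) × StExpr × StExpr => (true, p.1.2))
        (by fun_prop))
      (PT.comp g3 (f := fun p : (ℕ × List FOFormula) × StExpr × StExpr => (true, p.1.2))
        (by fun_prop))
      (PT.comp g4 (f := fun p : (ℕ × List FOFormula) × StExpr × StExpr => (true, p.1.2))
        (by fun_prop))
    exact PT.comp h (f := fun p : ℕ × StExpr × List FOFormula => ((p.1, p.2.2), p.2.1))
      (by fun_prop)
  · intro c x s
    cases x <;> simp [StExpr.trans]
  · intro c x
    cases x with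
    | all =>
      have := hq0 c
      have := eval_mono q0 (show sz c ≤ sz c + sz StExpr.all by simp)
      simp at *; omega
    | symb w =>
      have := hq1 (c, w)
      have := eval_mono q1 (show sz (c, w) ≤ sz c + sz (StExpr.symb w) by
        change _ ≤ sz c + (3 + sz w + 1); simp)
      simp at *; omega
    | union e f => simp [StExpr.trans, FOFormula.or]; omega
    | inter e f => simp [StExpr.trans]
    | diff e f => simp [StExpr.trans]; omega

/-- The translation of formulas without modal operators; modal operators are ignored. -/
def Formula.transFree (i : ℕ) : Formula → FOFormula
  | atom P ts => .atom (.copy P i) ts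
  | neg φ => .neg (Formula.transFree i φ)
  | and φ ψ => .and (Formula.transFree i φ) (Formula.transFree i ψ)
  | all x φ => .all x (Formula.transFree i φ)
  | box _ φ => Formula.transFree i φ

/-- The translation of formulas without nested modal operators. -/
def Formula.transUnnested (n i : ℕ) : Formula → FOFormula
  | atom P ts => .atom (.copy P i) ts
  | neg φ => .neg (Formula.transUnnested n i φ)
  | and φ ψ => .and (Formula.transUnnested n i φ) (Formula.transUnnested n i ψ)
  | all x φ => .all x (Formula.transUnnested n i φ)
  | box e φ => .conj ((List.range n).map fun j => (e.trans j).imp (Formula.transFree j φ))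

@[fun_prop]
theorem PT.transFree {f : γ → ℕ} {g : γ → Formula} (hf : PT f) (hg : PT g) :
    PT fun c => (g c).transFree (f c) := by
  have := PT.formula_rec (γ := ℕ) (V := Formula.transFree)
    (f1 := fun _ _ v => v.neg) (f2 := fun _ _ u v => .and u v)
    (f3 := fun _ p v => .all p.1 v) (f4 := fun _ _ v => v)
    (by simp only [Formula.transFree]; fun_prop) (by fun_prop) (by fun_prop) (by fun_prop)
    (by fun_prop) (by simp [Formula.transFree]) (.X + 10) (by
      intro c
      refine ⟨?_, ?_, ?_, ?_⟩ <;> (intros; simp [Formula.transFree]; try omega))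
  exact PT.comp this (f := fun c => (f c, g c)) (by fun_prop)

-- The scope of a modal operator is copied `n` times. Nested operators would make the growth
-- exponential in the depth; here the scopes are translated by `Formula.transFree`, so the factor is
-- incurred only once.
@[fun_prop]
theorem PT.transUnnested {f f' : γ → ℕ} {g : γ → Formula} (hf : PT f) (hf' : PT f') (hg : PT g) :
    PT fun c => (g c).transUnnested (f c) (f' c) := by
  have hl : PT fun p : (ℕ × ℕ) × StExpr × Formula => FOFormula.conj ((List.range p.1.1).map
    fun j => (p.2.1.trans j).imp (p.2.2.transFree j)) := by fun_prop
  obtain ⟨q, hq⟩ := hl.sz_le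
  have := PT.formula_rec (γ := ℕ × ℕ) (V := fun c => Formula.transUnnested c.1 c.2)
    (f1 := fun _ _ v => v.neg) (f2 := fun _ _ u v => .and u v)
    (f3 := fun _ p v => .all p.1 v) (f4 := fun c p _ => FOFormula.conj ((List.range c.1).map
      fun j => (p.1.trans j).imp (p.2.transFree j)))
    (by simp only [Formula.transUnnested]; fun_prop) (by fun_prop) (by fun_prop) (by fun_prop)
    (PT.comp hl (f := fun p : ((ℕ × ℕ) × StExpr × Formula) × FOFormula => p.1) (by fun_prop))
    (by simp [Formula.transUnnested]) (q + .X + 10) (by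
      intro c
      refine ⟨?_, ?_, ?_, ?_⟩ <;> intros <;> simp [Formula.transUnnested]
      · omega
      · rename_i e φ
        have h1 := hq (c, e, φ)
        have h2 := eval_mono q (show sz (c, e, φ) ≤ sz c + sz (φ.box e) by simp)
        simp at *
        omega)
  exact PT.comp this (f := fun c => ((f c, f' c), g c)) (by fun_prop)

/-- No modal operator is in the scope of another one. -/
def Formula.Unnested : Formula → Prop
  | atom _ _ => True
  | neg φ => φ.Unnested
  | and φ ψ => φ.Unnested ∧ ψ.Unnested
  | all _ φ => φ.Unnested
  | box _ φ => φ.boxes = []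

theorem Formula.transFree_eq (n i : ℕ) {φ : Formula} (h : φ.boxes = []) :
    φ.transAt n i = φ.transFree i := by
  induction φ <;> simp_all [Formula.transAt, Formula.transFree, Formula.boxes]

theorem Formula.transUnnested_eq (n i : ℕ) {φ : Formula} (h : φ.Unnested) :
    φ.transAt n i = φ.transUnnested n i := by
  induction φ with
  | box e φ _ =>
    simp only [Formula.transAt, Formula.transUnnested]
    congr 2
    funext j
    rw [Formula.transFree_eq n j h]
  | _ => simp_all [Formula.transAt, Formula.transUnnested, Formula.Unnested]

theorem Formula.boxes_closedFlatten (φ ψ : Formula) : (φ.closedFlatten ψ).boxes = [] := by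
  induction ψ <;> simp_all [Formula.closedFlatten, Formula.boxes, Formula.closedLabel]

theorem Formula.unnested_closedFlattenNested (φ ψ : Formula) :
    (φ.closedFlattenNested ψ).Unnested := by
  induction ψ <;> simp_all [Formula.closedFlattenNested, Formula.Unnested,
    Formula.boxes_closedFlatten]

theorem Formula.unnested_localDefinition (φ : Formula) (pos nested : Bool) (ψ : Formula) :
    ∀ χ ∈ φ.localDefinition pos nested ψ, χ.Unnested := by
  cases ψ <;> simp [Formula.localDefinition]
  cases pos <;> cases nested <;>
    simp [Formula.imp, Formula.Unnested, Formula.closedLabel, Formula.boxes_closedFlatten]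

theorem Formula.unnested_closedSsnf (φ : Formula) : φ.closedSsnf.Unnested := by
  have key : ∀ (l : List Formula) (ψ : Formula), ψ.Unnested → (∀ χ ∈ l, χ.Unnested) →
      (l.foldl Formula.and ψ).Unnested := by
    intro l
    induction l with
    | nil => intro ψ h _; exact h
    | cons χ l ih =>
      intro ψ h1 h2
      exact ih _ ⟨h1, h2 χ (by simp)⟩ fun χ' h => h2 χ' (by simp [h])
  refine key _ _ (φ.unnested_closedFlattenNested φ) fun χ hχ => ?_
  obtain ⟨p, -, hp⟩ := List.mem_flatMap.1 hχ
  exact φ.unnested_localDefinition _ _ _ χ hp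

/-- On sentential formulas, the translation of the normal form is computed in polynomial time. -/
theorem exists_pt_trans_ssnf : ∃ f : Formula → FOFormula, PT f ∧
    ∀ φ : Formula, φ.Sentential → f φ = φ.ssnf.trans φ.size := by
  refine ⟨fun φ => .and
    (.conj ((List.range φ.size).map fun i => φ.closedSsnf.transUnnested φ.size i))
    (.conj ((List.range φ.size).map fun i => .atom (.stand none i) [])), ?_, fun φ h => ?_⟩
  · have := pt_closedSsnf
    fun_prop
  · rw [Formula.ssnf_eq h, Formula.trans]
    simp only [Formula.transUnnested_eq _ _ φ.unnested_closedSsnf]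
end

/-! ## Free variables -/

theorem Term.eval_congr {Δ : Type} (I : FOStructure Δ) {v w : Ident → Δ} {t : Term}
    (h : ∀ x ∈ t.vars, v x = w x) : t.eval I v = t.eval I w := by
  cases t with
  | var x => exact h x (by simp [Term.vars])
  | const a => rfl

theorem Formula.holds_congr (M : StandpointStructure) (φ : Formula) (p : M.Prec)
    {v w : Ident → M.Δ} (h : ∀ x ∈ φ.freeVars, v x = w x) : φ.Holds M p v ↔ φ.Holds M p w := by
  induction φ generalizing p v w with
  | atom P ts =>
    have : ts.map (Term.eval (M.γ p) v) = ts.map (Term.eval (M.γ p) w) :=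
      List.map_congr_left fun t ht => Term.eval_congr _ fun x hx => h x (by
        simp only [Formula.freeVars, List.mem_dedup, List.mem_flatMap]; exact ⟨t, ht, hx⟩)
    simp only [Formula.Holds, this]
  | neg φ ih => exact not_congr (ih p h)
  | and φ ψ ih ih' =>
    exact and_congr (ih p fun x hx => h x (by simp [Formula.freeVars, hx]))
      (ih' p fun x hx => h x (by simp [Formula.freeVars, hx]))
  | all x φ ih =>
    refine forall_congr' fun d => ih p fun y hy => ?_
    by_cases hxy : y = x
    · subst hxy; simp
    · simp only [Function.update_of_ne hxy]
      exact h y (by simp [Formula.freeVars, hy, hxy])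
  | box e φ ih => exact forall₂_congr fun q _ => ih q h

theorem Formula.Closed.holds_iff {M : StandpointStructure} {φ : Formula} (h : φ.Closed)
    (p : M.Prec) (v w : Ident → M.Δ) : φ.Holds M p v ↔ φ.Holds M p w :=
  φ.holds_congr M p fun x hx => by rw [h] at hx; simp at hx

/-! ## Small models -/

/-- The structure with the precisifications `g i`. -/
def StandpointStructure.pullback (M : StandpointStructure) {P : Type} (hP : Nonempty P)
    (g : P → M.Prec) : StandpointStructure where
  Δ := M.Δ
  Prec := P
  nonempty_domain := M.nonempty_domain
  nonempty_prec := hP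
  σ s := {i | g i ∈ M.σ s}
  γ i := M.γ (g i)
  rigid i j := M.rigid (g i) (g j)

section
variable {M : StandpointStructure} {P : Type} (hP : Nonempty P) (g : P → M.Prec)

theorem StExpr.eval_pullback (e : StExpr) (i : P) :
    i ∈ e.eval (M.pullback hP g) ↔ g i ∈ e.eval M := by
  induction e with
  | all => exact ⟨fun _ => trivial, fun _ => trivial⟩
  | symb s => rfl
  | union e f ih ih' => exact or_congr ih ih'
  | inter e f ih ih' => exact and_congr ih ih'
  | diff e f ih ih' => exact and_congr ih (not_congr ih')

/-- The hypothesis says that the selected precisifications refute every modal subformula that is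
refuted at all. Then passing to them does not change the truth value of any modal subformula. -/
theorem Formula.holds_pullback (φ : Formula)
    (h : ∀ e ψ, Formula.box e ψ ∈ φ.sub → ∀ v, (∀ i, g i ∈ e.eval M → ψ.Holds M (g i) v) →
      ∀ q ∈ e.eval M, ψ.Holds M q v) (i : P) (v : Ident → M.Δ) :
    φ.Holds (M.pullback hP g) i v ↔ φ.Holds M (g i) v := by
  induction φ generalizing i v with
  | atom P ts => rfl
  | neg φ ih => exact not_congr (ih (fun e ψ hψ => h e ψ (by simp [Formula.sub, hψ])) i v)
  | and φ ψ ih ih' =>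
    exact and_congr (ih (fun e ψ hψ => h e ψ (by simp [Formula.sub, hψ])) i v)
      (ih' (fun e ψ hψ => h e ψ (by simp [Formula.sub, hψ])) i v)
  | all x φ ih =>
    exact forall_congr' fun d => ih (fun e ψ hψ => h e ψ (by simp [Formula.sub, hψ])) i _
  | box e φ ih =>
    have ih := fun j => ih (fun e ψ hψ => h e ψ (by simp [Formula.sub, hψ])) j v
    constructor
    · intro hb
      exact h e φ (by simp [Formula.sub]) v fun j hj =>
        (ih j).1 (hb j ((e.eval_pullback hP g j).2 hj))
    · intro hb j hj
      exact (ih j).2 (hb _ ((e.eval_pullback hP g j).1 hj))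
end

theorem Formula.mem_sub_self (φ : Formula) : φ ∈ φ.sub := by cases φ <;> simp [Formula.sub]

theorem Formula.size_pos (φ : Formula) : 0 < φ.size := Finset.card_pos.2 ⟨φ, φ.mem_sub_self⟩

/-- Satisfiable sentential formulas are satisfiable with as many precisifications as subformulas. -/
theorem Formula.Satisfiable.exists_small {φ : Formula} (hs : φ.Sentential) (h : φ.Satisfiable) :
    ∃ (M : StandpointStructure) (_ : M.Prec ≃ Fin φ.size), ∀ p v, φ.Holds M p v := by
  obtain ⟨M, hM⟩ := h
  obtain ⟨p0⟩ := M.nonempty_prec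
  -- For each subformula one precisification is selected: a counterexample if it is a modal formula
  -- that fails, and an arbitrary one otherwise.
  have : ∀ χ : φ.sub, ∃ q : M.Prec, ∀ e ψ, χ.1 = Formula.box e ψ → ∀ v,
      (q ∈ e.eval M → ψ.Holds M q v) → ∀ q ∈ e.eval M, ψ.Holds M q v := by
    rintro ⟨χ, hχ⟩
    by_cases hw : ∃ e ψ, χ = Formula.box e ψ ∧ ∃ v, ∃ q ∈ e.eval M, ¬ ψ.Holds M q v
    · obtain ⟨e, ψ, rfl, v, q, hq, hψ⟩ := hw
      refine ⟨q, fun e' ψ' he v' hv' => ?_⟩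
      injection he with h1 h2
      subst h1 h2
      -- Since `ψ` is closed, the counterexample found under the assignment `v` is one under every
      -- assignment.
      exact absurd (((hs e ψ hχ).holds_iff q v' v).1 (hv' hq)) hψ
    · push Not at hw
      exact ⟨p0, fun e ψ he v _ q hq => hw e ψ he v q hq⟩
  choose g hg using this
  -- The subformulas themselves serve as indices of precisifications. Repetitions under `g` are
  -- harmless, and the number is exactly `φ.size`.
  refine ⟨M.pullback ⟨⟨φ, φ.mem_sub_self⟩⟩ g, φ.sub.equivFin, fun p v => ?_⟩
  refine (φ.holds_pullback _ g (fun e ψ hψ v hv => ?_) p v).2 (hM _ v)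
  exact hg ⟨_, hψ⟩ e ψ rfl v (hv _)

/-! ## Correctness of the normal form -/

theorem Formula.holds_foldl_and {M : StandpointStructure} {p : M.Prec} {v : Ident → M.Δ}
    (l : List Formula) (ψ : Formula) :
    (l.foldl Formula.and ψ).Holds M p v ↔ ψ.Holds M p v ∧ ∀ χ ∈ l, χ.Holds M p v := by
  induction l generalizing ψ with
  | nil => simp
  | cons a l ih => simp [ih, Formula.Holds, and_assoc]

theorem Formula.holds_imp {M : StandpointStructure} {p : M.Prec} {v : Ident → M.Δ}
    (φ ψ : Formula) : (φ.imp ψ).Holds M p v ↔ (φ.Holds M p v → ψ.Holds M p v) := by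
  simp [Formula.imp, Formula.Holds]

theorem Formula.holds_of_alls {M : StandpointStructure} {p : M.Prec} (l : List Ident)
    (φ : Formula) (v : Ident → M.Δ) (h : (Formula.alls l φ).Holds M p v) : φ.Holds M p v := by
  induction l with
  | nil => exact h
  | cons x l ih =>
    have := h (v x)
    rw [Function.update_eq_self] at this
    exact ih this

/-- Only one implication between a modal formula and its label is available, the one fitting the
polarity of the occurrence. Negation swaps the two; in the modal case the definition is combined
with the induction hypothesis at all precisifications, so the definitions must hold everywhere. -/
theorem Formula.holds_of_flatten {M : StandpointStructure} (φ : Formula) (ψ : Formula) (pos : Bool)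
    (h : ∀ χ ∈ φ.definitions pos true ψ, ∀ p v, χ.Holds M p v) (p : M.Prec) (v : Ident → M.Δ) :
    if pos then (φ.flatten ψ).Holds M p v → ψ.Holds M p v
    else ψ.Holds M p v → (φ.flatten ψ).Holds M p v := by
  induction ψ generalizing pos p v with
  | atom P ts => cases pos <;> exact fun h => h
  | neg ψ ih =>
    have := ih (!pos) h p v
    cases pos <;> exact mt this
  | and ψ χ ih ih' =>
    have h1 := ih pos (fun χ hχ => h χ (by simp [Formula.definitions, hχ])) p v
    have h2 := ih' pos (fun χ hχ => h χ (by simp [Formula.definitions, hχ])) p v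
    cases pos <;> exact And.imp h1 h2
  | all x ψ ih =>
    have h1 := fun v => ih pos h p v
    cases pos <;> exact fun h d => h1 _ (h d)
  | box e ψ ih =>
    have h1 := fun p => ih pos (fun χ hχ => h χ (by simp [Formula.definitions, hχ])) p v
    have h2 := Formula.holds_of_alls _ _ _ (h _ (by
      simp only [Formula.definitions, if_true]
      exact List.mem_append_left _ (List.mem_singleton.2 rfl)) p v)
    cases pos
    · simp only [Bool.false_eq_true, if_false, Formula.holds_imp] at h2 h1 ⊢
      exact fun hb => h2 fun q hq => h1 q (hb q hq)
    · simp only [if_true, Formula.holds_imp] at h2 h1 ⊢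
      exact fun hl q hq => h1 q (h2 hl q hq)

theorem Formula.holds_of_flattenNested {M : StandpointStructure} (φ : Formula) (ψ : Formula)
    (pos : Bool) (h : ∀ χ ∈ φ.definitions pos false ψ, ∀ p v, χ.Holds M p v) (p : M.Prec)
    (v : Ident → M.Δ) :
    if pos then (φ.flattenNested ψ).Holds M p v → ψ.Holds M p v
    else ψ.Holds M p v → (φ.flattenNested ψ).Holds M p v := by
  induction ψ generalizing pos p v with
  | atom P ts => cases pos <;> exact fun h => h
  | neg ψ ih =>
    have := ih (!pos) h p v
    cases pos <;> exact mt this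
  | and ψ χ ih ih' =>
    have h1 := ih pos (fun χ hχ => h χ (by simp [Formula.definitions, hχ])) p v
    have h2 := ih' pos (fun χ hχ => h χ (by simp [Formula.definitions, hχ])) p v
    cases pos <;> exact And.imp h1 h2
  | all x ψ ih =>
    have h1 := fun v => ih pos h p v
    cases pos <;> exact fun h d => h1 _ (h d)
  | box e ψ ih =>
    have h1 := fun p => φ.holds_of_flatten ψ pos
      (fun χ hχ => h χ (by simp [Formula.definitions, hχ])) p v
    cases pos <;> exact fun h q hq => h1 q (h q hq)

theorem Formula.holds_of_ssnf {M : StandpointStructure} {φ : Formula}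
    (h : ∀ p v, φ.ssnf.Holds M p v) (p : M.Prec) (v : Ident → M.Δ) : φ.Holds M p v := by
  simp only [Formula.ssnf, Formula.holds_foldl_and] at h
  exact φ.holds_of_flattenNested φ true (fun χ hχ p v => (h p v).2 χ hχ) p v (h p v).1

/-! ### Fresh labels and the expansion of models. -/

def Formula.labelName (φ ψ : Formula) : PredName :=
  .base (List.replicate (φ.code.size + φ.boxes.idxOf ψ) true)

/-- The length of the name determines the index in the list of modal subformulas. One of the two
formulas must be in that list, as all formulas outside it share the same index. -/
theorem Formula.labelName_inj {φ ψ χ : Formula} (h : ψ ∈ φ.boxes)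
    (he : φ.labelName ψ = φ.labelName χ) : ψ = χ := by
  simp only [Formula.labelName, PredName.base.injEq] at he
  have := congrArg List.length he
  simp only [List.length_replicate] at this
  exact (List.idxOf_inj h).1 (by omega)

theorem Formula.code_size_lt {φ : Formula} {P : PredName} {ts : List Term}
    (h : Formula.atom P ts ∈ φ.sub) : P.code.size < φ.code.size := by
  induction φ with
  | atom Q us =>
    simp only [Formula.sub, Finset.mem_singleton, Formula.atom.injEq] at h
    obtain ⟨rfl, rfl⟩ := h
    simp only [Formula.code, Data.tag, Data.size]; omega
  | neg φ ih =>
    have := ih (by simpa [Formula.sub] using h)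
    simp only [Formula.code, Data.tag, Data.size]; omega
  | and φ ψ ih ih' =>
    simp only [Formula.sub, Finset.mem_insert, reduceCtorEq, Finset.mem_union, false_or] at h
    simp only [Formula.code, Data.tag, Data.size]
    rcases h with h | h
    · have := ih h; omega
    · have := ih' h; omega
  | all x φ ih =>
    have := ih (by simpa [Formula.sub] using h)
    simp only [Formula.code, Data.tag, Data.size]; omega
  | box e φ ih =>
    have := ih (by simpa [Formula.sub] using h)
    simp only [Formula.code, Data.tag, Data.size]; omega

/-- A label name is a word at least as long as the code of `φ` is large, whereas the code of a
predicate occurring in `φ` is smaller than that of `φ`. -/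
theorem Formula.ne_labelName {φ : Formula} {P : PredName} {ts : List Term}
    (h : Formula.atom P ts ∈ φ.sub) (ψ : Formula) : P ≠ φ.labelName ψ := by
  rintro rfl
  have h1 := Formula.code_size_lt h
  have h2 := length_le_sz (List.replicate (φ.code.size + φ.boxes.idxOf ψ) true)
  rw [List.length_replicate] at h2
  have h3 : (φ.labelName ψ).code.size =
      1 + sz (List.replicate (φ.code.size + φ.boxes.idxOf ψ) true) + 1 := rfl
  omega

theorem Formula.boxes_subset {φ ψ : Formula} (h : ψ ∈ φ.sub) : ∀ χ ∈ ψ.boxes, χ ∈ φ.boxes := by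
  induction φ with
  | atom P ts =>
    obtain rfl := Finset.mem_singleton.1 h
    exact fun _ h => h
  | neg φ ih | all _ φ ih =>
    rcases Finset.mem_insert.1 h with rfl | h
    · exact fun _ h => h
    · exact ih h
  | and φ ψ ih ih' =>
    simp only [Formula.sub, Finset.mem_insert, Finset.mem_union] at h
    rcases h with rfl | h | h
    · exact fun _ h => h
    · exact fun χ hχ => List.mem_append_left _ (ih h χ hχ)
    · exact fun χ hχ => List.mem_append_right _ (ih' h χ hχ)
  | box e φ ih =>
    rcases Finset.mem_insert.1 h with rfl | h
    · exact fun _ h => h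
    · exact fun χ hχ => List.mem_cons_of_mem _ (ih h χ hχ)

/-- The expansion of `M` by the labels of the modal subformulas of `φ`. -/
def StandpointStructure.expand (M : StandpointStructure) (φ : Formula) : StandpointStructure where
  Δ := M.Δ
  Prec := M.Prec
  nonempty_domain := M.nonempty_domain
  nonempty_prec := M.nonempty_prec
  σ := M.σ
  γ p :=
    { rel := fun P l =>
        -- For a closed modal formula, truth everywhere is the same as truth at one precisification
        -- under one assignment, so a label can be interpreted uniformly and without regard to
        -- arguments.
        (∃ χ ∈ φ.boxes, P = φ.labelName χ ∧ ∀ q v, χ.Holds M q v) ∨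
          (∀ χ, P ≠ φ.labelName χ) ∧ (M.γ p).rel P l
      const := (M.γ p).const }
  rigid := M.rigid

section
variable (M : StandpointStructure) (φ : Formula)

theorem StExpr.eval_expand (e : StExpr) : e.eval (M.expand φ) = e.eval M := by
  induction e with
  | all | symb s => rfl
  | union e f ih ih' | inter e f ih ih' | diff e f ih ih' => simp only [StExpr.eval, ih, ih']; rfl

theorem Term.eval_expand (p : M.Prec) (v : Ident → M.Δ) (t : Term) :
    t.eval ((M.expand φ).γ p) v = t.eval (M.γ p) v := by cases t <;> rfl

theorem Formula.holds_label_expand {ψ : Formula} {e : StExpr} (hψ : Formula.box e ψ ∈ φ.sub)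
    (hc : ψ.Closed) (p : M.Prec) (v : Ident → M.Δ) :
    (φ.label (.box e ψ)).Holds (M.expand φ) p v ↔ (Formula.box e ψ).Holds M p v := by
  have hb : (Formula.box e ψ).Closed := hc
  rw [Formula.label_eq hb]
  have hmem : Formula.box e ψ ∈ φ.boxes := Formula.boxes_subset hψ _ (by simp [Formula.boxes])
  constructor
  · rintro (⟨χ, hχ, h1, h2⟩ | ⟨h, -⟩)
    · obtain rfl := Formula.labelName_inj hmem h1
      exact h2 p v
    · exact absurd rfl (h (.box e ψ))
  · intro h
    refine Or.inl ⟨_, hmem, rfl, fun q w => ?_⟩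
    exact (hb.holds_iff (M := M) q v w).1 h

theorem Formula.holds_flatten_expand (ψ : Formula) (hψ : ψ.sub ⊆ φ.sub) (hs : ψ.Sentential)
    (p : M.Prec) (v : Ident → M.Δ) :
    (φ.flatten ψ).Holds (M.expand φ) p v ↔ ψ.Holds M p v := by
  induction ψ generalizing v with
  | atom P ts =>
    have hP := Formula.ne_labelName (hψ (Formula.mem_sub_self _))
    have : ts.map (Term.eval ((M.expand φ).γ p) v) = ts.map (Term.eval (M.γ p) v) :=
      List.map_congr_left fun t _ => t.eval_expand M φ p v
    simp only [Formula.flatten, Formula.Holds, this]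
    constructor
    · rintro (⟨χ, -, h, -⟩ | ⟨-, h⟩)
      · exact absurd h (hP χ)
      · exact h
    · exact fun h => Or.inr ⟨hP, h⟩
  | neg ψ ih =>
    exact not_congr (ih ((Finset.subset_insert _ _).trans hψ) hs.neg v)
  | and ψ χ ih ih' =>
    have h := (Finset.subset_insert _ _).trans hψ
    exact and_congr (ih (Finset.subset_union_left.trans h) hs.and_left v)
      (ih' (Finset.subset_union_right.trans h) hs.and_right v)
  | all x ψ ih =>
    exact forall_congr' fun d => ih ((Finset.subset_insert _ _).trans hψ) hs.all _
  | box e ψ ih =>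
    exact φ.holds_label_expand M (hψ (Formula.mem_sub_self _)) hs.closed p v

theorem Formula.holds_box_expand {ψ : Formula} {e : StExpr} (hψ : (Formula.box e ψ).sub ⊆ φ.sub)
    (hs : (Formula.box e ψ).Sentential) (p : M.Prec) (v : Ident → M.Δ) :
    (Formula.box e (φ.flatten ψ)).Holds (M.expand φ) p v ↔ (Formula.box e ψ).Holds M p v := by
  simp only [Formula.Holds, StExpr.eval_expand]
  exact forall₂_congr fun q _ =>
    φ.holds_flatten_expand M ψ ((Finset.subset_insert _ _).trans hψ) hs.box q v

theorem Formula.holds_flattenNested_expand (ψ : Formula) (hψ : ψ.sub ⊆ φ.sub) (hs : ψ.Sentential)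
    (p : M.Prec) (v : Ident → M.Δ) :
    (φ.flattenNested ψ).Holds (M.expand φ) p v ↔ ψ.Holds M p v := by
  induction ψ generalizing v with
  | atom P ts => exact φ.holds_flatten_expand M _ hψ hs p v
  | neg ψ ih =>
    exact not_congr (ih ((Finset.subset_insert _ _).trans hψ) hs.neg v)
  | and ψ χ ih ih' =>
    have h := (Finset.subset_insert _ _).trans hψ
    exact and_congr (ih (Finset.subset_union_left.trans h) hs.and_left v)
      (ih' (Finset.subset_union_right.trans h) hs.and_right v)
  | all x ψ ih =>
    exact forall_congr' fun d => ih ((Finset.subset_insert _ _).trans hψ) hs.all _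
  | box e ψ ih => exact φ.holds_box_expand M hψ hs p v

/-- In the expansion a label is equivalent to its modal formula, so both directions of the
definition hold and polarity plays no role. -/
theorem Formula.holds_definitions_expand (ψ : Formula) (hψ : ψ.sub ⊆ φ.sub) (hs : ψ.Sentential)
    (pos nested : Bool) (p : M.Prec) (v : Ident → M.Δ) :
    ∀ χ ∈ φ.definitions pos nested ψ, χ.Holds (M.expand φ) p v := by
  induction ψ generalizing pos nested with
  | atom P ts => simp [Formula.definitions]
  | neg ψ ih => exact ih ((Finset.subset_insert _ _).trans hψ) hs.neg _ _
  | and ψ χ ih ih' =>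
    have h := (Finset.subset_insert _ _).trans hψ
    intro ξ hξ
    rcases List.mem_append.1 hξ with hξ | hξ
    · exact ih (Finset.subset_union_left.trans h) hs.and_left _ _ ξ hξ
    · exact ih' (Finset.subset_union_right.trans h) hs.and_right _ _ ξ hξ
  | all x ψ ih => exact ih ((Finset.subset_insert _ _).trans hψ) hs.all _ _
  | box e ψ ih =>
    intro ξ hξ
    rcases List.mem_append.1 hξ with hξ | hξ
    · cases nested
      · simp at hξ
      have hc : ψ.freeVars = [] := hs.closed
      have h1 := φ.holds_label_expand M (hψ (Formula.mem_sub_self _)) hs.closed p v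
      have h2 := φ.holds_box_expand M hψ hs p v
      simp only [if_true, List.mem_singleton, hc, Formula.alls, List.foldr_nil] at hξ
      subst hξ
      cases pos
      · exact (Formula.holds_imp _ _).2 fun h => h1.2 (h2.1 h)
      · exact (Formula.holds_imp _ _).2 fun h => h2.2 (h1.1 h)
    · exact ih ((Finset.subset_insert _ _).trans hψ) hs.box _ _ ξ hξ

theorem Formula.holds_ssnf_expand (hs : φ.Sentential) (p : M.Prec) (v : Ident → M.Δ)
    (h : φ.Holds M p v) : φ.ssnf.Holds (M.expand φ) p v :=
  (Formula.holds_foldl_and _ _).2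
    ⟨(φ.holds_flattenNested_expand M φ subset_rfl hs p v).2 h,
      φ.holds_definitions_expand M φ subset_rfl hs _ _ p v⟩
end

/-! ## Correctness of the translation -/

section
variable {Δ : Type} {I : FOStructure Δ} {v : Ident → Δ}

theorem FOFormula.holds_imp (φ ψ : FOFormula) :
    (φ.imp ψ).Holds I v ↔ (φ.Holds I v → ψ.Holds I v) := by
  simp [FOFormula.imp, FOFormula.Holds]

theorem FOFormula.holds_or (φ ψ : FOFormula) :
    (φ.or ψ).Holds I v ↔ (φ.Holds I v ∨ ψ.Holds I v) := by
  simp [FOFormula.or, FOFormula.Holds]; tauto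

theorem FOFormula.holds_conj (l : List FOFormula) :
    (FOFormula.conj l).Holds I v ↔ ∀ φ ∈ l, φ.Holds I v := by
  induction l with
  | nil => simp [FOFormula.conj, FOFormula.Holds]
  | cons φ l ih =>
    cases l with
    | nil => simp [FOFormula.conj]
    | cons ψ l => rw [FOFormula.conj, FOFormula.Holds, ih]; simp
end

/-- The first-order structure `I` describes `M`, whose precisifications are `g 0, …, g (n - 1)`. -/
structure Describes (M : StandpointStructure) (n : ℕ) (g : ℕ → M.Prec) (I : FOStructure M.Δ) :
    Prop where
  surj : ∀ p, ∃ i < n, g i = p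
  rel : ∀ i < n, ∀ P l, I.rel (.copy P i) l ↔ (M.γ (g i)).rel P l
  stand : ∀ i < n, ∀ s, I.rel (.stand (some s) i) [] ↔ g i ∈ M.σ s
  all : ∀ i < n, I.rel (.stand none i) []
  const : ∀ p a, (M.γ p).const a = I.const a

section
variable {M : StandpointStructure} {n : ℕ} {g : ℕ → M.Prec} {I : FOStructure M.Δ}

theorem Describes.expr (h : Describes M n g I) {i : ℕ} (hi : i < n) (v : Ident → M.Δ)
    (e : StExpr) : (e.trans i).Holds I v ↔ g i ∈ e.eval M := by
  induction e with
  | all => simpa [StExpr.trans, FOFormula.Holds, StExpr.eval] using h.all i hi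
  | symb s => exact h.stand i hi s
  | union e f ih ih' => rw [StExpr.trans, FOFormula.holds_or, ih, ih']; rfl
  | inter e f ih ih' => exact and_congr ih ih'
  | diff e f ih ih' => exact and_congr ih (not_congr ih')

/-- In the modal case the finite conjunction over indices is the quantification over
precisifications, because every precisification has an index below `n`. -/
theorem Describes.transAt (h : Describes M n g I) (φ : Formula) {i : ℕ} (hi : i < n)
    (v : Ident → M.Δ) : (φ.transAt n i).Holds I v ↔ φ.Holds M (g i) v := by
  induction φ generalizing i v with
  | atom P ts =>
    have : ts.map (Term.eval I v) = ts.map (Term.eval (M.γ (g i)) v) := by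
      refine List.map_congr_left fun t _ => ?_
      cases t with
      | var x => rfl
      | const a => exact (h.const _ a).symm
    simp only [Formula.transAt, FOFormula.Holds, Formula.Holds, this, h.rel i hi]
  | neg φ ih => exact not_congr (ih hi v)
  | and φ ψ ih ih' => exact and_congr (ih hi v) (ih' hi v)
  | all x φ ih => exact forall_congr' fun d => ih hi _
  | box e φ ih =>
    simp only [Formula.transAt, FOFormula.holds_conj, List.mem_map, List.mem_range,
      forall_exists_index, and_imp, forall_apply_eq_imp_iff₂, FOFormula.holds_imp]
    constructor
    · intro hb q hq
      obtain ⟨j, hj, rfl⟩ := h.surj q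
      exact (ih hj v).1 (hb j hj ((h.expr hj v e).2 hq))
    · intro hb j hj he
      exact (ih hj v).2 (hb _ ((h.expr hj v e).1 he))

theorem Describes.trans (h : Describes M n g I) (φ : Formula) (v : Ident → M.Δ) :
    (φ.trans n).Holds I v ↔ ∀ p, φ.Holds M p v := by
  simp only [Formula.trans, FOFormula.Holds, FOFormula.holds_conj, List.mem_map, List.mem_range,
    forall_exists_index, and_imp, forall_apply_eq_imp_iff₂, List.map_nil]
  constructor
  · rintro ⟨h1, -⟩ p
    obtain ⟨i, hi, rfl⟩ := h.surj p
    exact (h.transAt φ hi v).1 (h1 i hi)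
  · exact fun hp => ⟨fun i hi => (h.transAt φ hi v).2 (hp _), h.all⟩
end

theorem Formula.satisfiable_trans {φ : Formula} {n : ℕ} {M : StandpointStructure}
    (e : M.Prec ≃ Fin n) (h : ∀ p v, φ.Holds M p v) : (φ.trans n).Satisfiable := by
  obtain ⟨p0⟩ := M.nonempty_prec
  -- Indices from `n` on do not occur in the translation; their value `p0` is arbitrary.
  let g : ℕ → M.Prec := fun i => if h : i < n then e.symm ⟨i, h⟩ else p0
  let I : FOStructure M.Δ :=
    { rel := fun P l => match P with
        | .base _ => True
        | .copy P i => (M.γ (g i)).rel P l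
        | .stand none _ => True
        | .stand (some s) i => g i ∈ M.σ s
      const := (M.γ p0).const }
  have hd : Describes M n g I :=
    { surj := fun p => ⟨e p, (e p).2, by simp [g]⟩
      rel := fun _ _ _ _ => Iff.rfl
      stand := fun _ _ _ => Iff.rfl
      all := fun _ _ => trivial
      const := fun p a => M.rigid p p0 a }
  exact ⟨M.Δ, M.nonempty_domain, I, fun v => (hd.trans φ v).2 fun p => h p v⟩

/-- The precisifications are the indices below `n`, each with its own copies of the predicates; `hn`
ensures that there is one. Constants have no copies and are therefore rigid. -/
theorem Formula.exists_model_of_trans {φ : Formula} {n : ℕ} (hn : 0 < n)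
    (h : (φ.trans n).Satisfiable) : ∃ M : StandpointStructure, ∀ p v, φ.Holds M p v := by
  obtain ⟨Δ, hΔ, I, hI⟩ := h
  let M : StandpointStructure :=
    { Δ := Δ
      Prec := Fin n
      nonempty_domain := hΔ
      nonempty_prec := ⟨⟨0, hn⟩⟩
      σ := fun s => {i | I.rel (.stand (some s) i) []}
      γ := fun i => ⟨fun P => I.rel (.copy P i), I.const⟩
      rigid := fun _ _ _ => rfl }
  obtain ⟨v0⟩ : Nonempty (Ident → Δ) := inferInstance
  -- The second conjunct of the translation forces `*` to contain all precisifications.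
  have hall : ∀ i < n, I.rel (.stand none i) [] := by
    have := (hI v0).2
    simpa [FOFormula.holds_conj, FOFormula.Holds] using this
  let g : ℕ → M.Prec := fun i => if h : i < n then ⟨i, h⟩ else ⟨0, hn⟩
  have hg : ∀ i < n, (g i : Fin n).1 = i := fun i hi => by simp [g, hi]
  have hd : Describes M n g I :=
    { surj := fun p => ⟨p.1, p.2, by simp [g]⟩
      rel := fun i hi P l => by
        change _ ↔ I.rel (.copy P (g i : Fin n).1) l
        rw [hg i hi]
      stand := fun i hi s => by
        change _ ↔ I.rel (.stand (some s) (g i : Fin n).1) []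
        rw [hg i hi]
      all := hall
      const := fun _ _ => rfl }
  exact ⟨M, fun p v => (hd.trans φ v).1 (hI v) p⟩

/-- The small model is taken for `φ` and expanded only afterwards. Expansion keeps the
precisifications, so the subformulas of `φ`, not those of its normal form, determine how many are
needed. -/
theorem Formula.satisfiable_trans_ssnf_iff {φ : Formula} (hs : φ.Sentential) :
    (φ.ssnf.trans φ.size).Satisfiable ↔ φ.Satisfiable := by
  constructor
  · intro h
    obtain ⟨M, hM⟩ := Formula.exists_model_of_trans φ.size_pos h
    exact ⟨M, Formula.holds_of_ssnf hM⟩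
  · intro h
    obtain ⟨M, e, hM⟩ := h.exists_small hs
    exact Formula.satisfiable_trans (M := M.expand φ) e
      fun p v => φ.holds_ssnf_expand M hs p v (hM p v)

/-! ## The translation yields sentences -/

theorem Formula.closed_iff {φ : Formula} : φ.Closed ↔ ∀ x, x ∉ φ.freeVars :=
  List.eq_nil_iff_forall_not_mem

/-- Labels are nullary here, so replacing subformulas by them can only remove variables. -/
theorem Formula.freeVars_flatten (φ : Formula) {ψ : Formula} (h : ψ.Sentential) (x : Ident) :
    x ∈ (φ.closedFlatten ψ).freeVars → x ∈ ψ.freeVars := by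
  induction ψ with
  | atom P ts => exact fun h => h
  | neg ψ ih => exact ih h.neg
  | and ψ χ ih ih' =>
    simp only [Formula.closedFlatten, Formula.freeVars, List.mem_union_iff]
    exact Or.imp (ih h.and_left) (ih' h.and_right)
  | all y ψ ih =>
    simp only [Formula.closedFlatten, Formula.freeVars, List.mem_filter]
    exact And.imp_left (ih h.all)
  | box e ψ ih => simp [Formula.closedFlatten, Formula.closedLabel, Formula.freeVars]

theorem Formula.freeVars_flattenNested (φ : Formula) {ψ : Formula} (h : ψ.Sentential) (x : Ident) :
    x ∈ (φ.closedFlattenNested ψ).freeVars → x ∈ ψ.freeVars := by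
  induction ψ with
  | atom P ts => exact fun h => h
  | neg ψ ih => exact ih h.neg
  | and ψ χ ih ih' =>
    simp only [Formula.closedFlattenNested, Formula.freeVars, List.mem_union_iff]
    exact Or.imp (ih h.and_left) (ih' h.and_right)
  | all y ψ ih =>
    simp only [Formula.closedFlattenNested, Formula.freeVars, List.mem_filter]
    exact And.imp_left (ih h.all)
  | box e ψ ih => exact φ.freeVars_flatten h.box x

theorem Formula.closed_definitions (φ : Formula) {ψ : Formula} (h : ψ.Sentential)
    (pos nested : Bool) : ∀ χ ∈ φ.definitions pos nested ψ, χ.Closed := by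
  induction ψ generalizing pos nested with
  | atom P ts => simp [Formula.definitions]
  | neg ψ ih => exact ih h.neg _ _
  | and ψ χ ih ih' =>
    intro ξ hξ
    rcases List.mem_append.1 hξ with hξ | hξ
    · exact ih h.and_left _ _ ξ hξ
    · exact ih' h.and_right _ _ ξ hξ
  | all x ψ ih => exact ih h.all _ _
  | box e ψ ih =>
    intro ξ hξ
    rcases List.mem_append.1 hξ with hξ | hξ
    · cases nested
      · simp at hξ
      have hc : ψ.freeVars = [] := h.closed
      have hb : (Formula.box e ψ).Closed := h.closed
      have h1 : (φ.closedFlatten ψ).freeVars = [] := Formula.closed_iff.2 fun x hx => by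
        have := φ.freeVars_flatten h.box x hx
        simp [hc] at this
      simp only [if_true, List.mem_singleton, hc, Formula.alls, List.foldr_nil,
        Formula.label_eq hb, φ.flatten_eq h.box] at hξ
      subst hξ
      cases pos <;>
        simp [Formula.Closed, Formula.imp, Formula.freeVars, h1, Formula.closedLabel]
    · exact ih h.box _ _ ξ hξ

theorem Formula.closed_ssnf {φ : Formula} (hs : φ.Sentential) (hc : φ.Closed) :
    φ.ssnf.Closed := by
  have key : ∀ (l : List Formula) (ψ : Formula), ψ.Closed → (∀ χ ∈ l, χ.Closed) →
      (l.foldl Formula.and ψ).Closed := by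
    intro l
    induction l with
    | nil => intro ψ h _; exact h
    | cons χ l ih =>
      intro ψ h1 h2
      refine ih _ ?_ fun χ' h => h2 χ' (by simp [h])
      have h3 : χ.freeVars = [] := h2 χ (by simp)
      have h1 : ψ.freeVars = [] := h1
      simp [Formula.Closed, Formula.freeVars, h1, h3]
  refine key _ _ ?_ (φ.closed_definitions hs _ _)
  rw [φ.flattenNested_eq hs]
  refine Formula.closed_iff.2 fun x hx => ?_
  have := φ.freeVars_flattenNested hs x hx
  rw [hc] at this
  simp at this

theorem FOFormula.mem_freeVars_conj {l : List FOFormula} {x : Ident}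
    (h : x ∈ (FOFormula.conj l).toFormula.freeVars) : ∃ φ ∈ l, x ∈ φ.toFormula.freeVars := by
  induction l with
  | nil => simp [FOFormula.conj, FOFormula.toFormula, Formula.freeVars] at h
  | cons φ l ih =>
    cases l with
    | nil => exact ⟨φ, by simp, h⟩
    | cons ψ l =>
      simp only [FOFormula.conj, FOFormula.toFormula, Formula.freeVars, List.mem_union_iff] at h
      rcases h with h | h
      · exact ⟨φ, by simp, h⟩
      · obtain ⟨χ, h1, h2⟩ := ih h
        exact ⟨χ, by simp [List.mem_cons.1 h1], h2⟩

theorem StExpr.closed_trans (i : ℕ) (e : StExpr) : (e.trans i).toFormula.freeVars = [] := by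
  induction e <;> simp_all [StExpr.trans, FOFormula.or, FOFormula.toFormula, Formula.freeVars]

theorem Formula.freeVars_transAt (n i : ℕ) (φ : Formula) (x : Ident) :
    x ∈ (φ.transAt n i).toFormula.freeVars → x ∈ φ.freeVars := by
  induction φ generalizing i with
  | atom P ts => exact fun h => h
  | neg φ ih => exact ih i
  | and φ ψ ih ih' =>
    simp only [Formula.transAt, FOFormula.toFormula, Formula.freeVars, List.mem_union_iff]
    exact Or.imp (ih i) (ih' i)
  | all y φ ih =>
    simp only [Formula.transAt, FOFormula.toFormula, Formula.freeVars, List.mem_filter]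
    exact And.imp_left (ih i)
  | box e φ ih =>
    intro h
    obtain ⟨χ, h1, h2⟩ := FOFormula.mem_freeVars_conj h
    obtain ⟨j, -, rfl⟩ := List.mem_map.1 h1
    simp only [FOFormula.imp, FOFormula.toFormula, Formula.freeVars, List.mem_union_iff,
      StExpr.closed_trans, List.not_mem_nil, false_or] at h2
    exact ih j h2

theorem Formula.closed_trans {φ : Formula} (h : φ.Closed) (n : ℕ) : (φ.trans n).Closed := by
  refine Formula.closed_iff.2 fun x hx => ?_
  simp only [Formula.trans, FOFormula.toFormula, Formula.freeVars, List.mem_union_iff] at hx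
  rcases hx with hx | hx
  · obtain ⟨χ, h1, h2⟩ := FOFormula.mem_freeVars_conj hx
    obtain ⟨j, -, rfl⟩ := List.mem_map.1 h1
    exact Formula.closed_iff.1 h x (φ.freeVars_transAt n j x h2)
  · obtain ⟨χ, h1, h2⟩ := FOFormula.mem_freeVars_conj hx
    obtain ⟨j, -, rfl⟩ := List.mem_map.1 h1
    simp [FOFormula.toFormula, Formula.freeVars] at h2

/-! ## First-order formulas as standpoint formulas -/

section
variable (φ : FOFormula)

theorem FOFormula.exists_of_mem_sub (ψ : Formula) (h : ψ ∈ φ.toFormula.sub) :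
    ∃ χ : FOFormula, χ.toFormula = ψ := by
  induction φ with
  | atom P ts => exact ⟨.atom P ts, (Finset.mem_singleton.1 h).symm⟩
  | neg φ ih =>
    rcases Finset.mem_insert.1 h with rfl | h
    · exact ⟨.neg φ, rfl⟩
    · exact ih h
  | all x φ ih =>
    rcases Finset.mem_insert.1 h with rfl | h
    · exact ⟨.all x φ, rfl⟩
    · exact ih h
  | and φ χ ih ih' =>
    simp only [FOFormula.toFormula, Formula.sub, Finset.mem_insert, Finset.mem_union] at h
    rcases h with rfl | h | h
    · exact ⟨.and φ χ, rfl⟩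
    · exact ih h
    · exact ih' h

theorem FOFormula.sentential_toFormula : φ.toFormula.Sentential := by
  intro e ψ h
  obtain ⟨χ, hχ⟩ := φ.exists_of_mem_sub _ h
  cases χ <;> cases hχ

/-- Without modal operators nothing is replaced and no definitions are added. -/
theorem FOFormula.ssnf_toFormula : φ.toFormula.ssnf = φ.toFormula := by
  have h1 : ∀ (θ : Formula) (φ : FOFormula) (pos nested : Bool),
      θ.definitions pos nested φ.toFormula = [] := by
    intro θ φ
    induction φ <;> simp_all [FOFormula.toFormula, Formula.definitions]
  have h2 : ∀ (θ : Formula) (φ : FOFormula), θ.flattenNested φ.toFormula = φ.toFormula := by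
    intro θ φ
    induction φ <;> simp_all [FOFormula.toFormula, Formula.flattenNested]
  rw [Formula.ssnf, h1, h2]
  rfl

theorem FOFormula.holds_toFormula (M : StandpointStructure) (p : M.Prec) (v : Ident → M.Δ) :
    φ.toFormula.Holds M p v ↔ φ.Holds (M.γ p) v := by
  induction φ generalizing v with
  | atom P ts => rfl
  | neg φ ih => exact not_congr (ih v)
  | and φ ψ ih ih' => exact and_congr (ih v) (ih' v)
  | all x φ ih => exact forall_congr' fun d => ih _

theorem FOFormula.satisfiable_toFormula : φ.toFormula.Satisfiable ↔ φ.Satisfiable := by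
  constructor
  · rintro ⟨M, hM⟩
    obtain ⟨p⟩ := M.nonempty_prec
    exact ⟨M.Δ, M.nonempty_domain, M.γ p, fun v => (φ.holds_toFormula M p v).1 (hM p v)⟩
  · rintro ⟨Δ, hΔ, I, hI⟩
    let M : StandpointStructure :=
      { Δ := Δ
        Prec := Unit
        nonempty_domain := hΔ
        nonempty_prec := ⟨()⟩
        σ := fun _ => ∅
        γ := fun _ => I
        rigid := fun _ _ _ => rfl }
    exact ⟨M, fun p v => (φ.holds_toFormula M p v).2 (hI v)⟩
end

/-- The quantified subformulas of the normal form are those of `φ` itself, to which closure under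
scopes applies. -/
theorem FOFormula.toFormula_mem {F : Set FOFormula} (hF : ClosedUnderScopes F) {φ : FOFormula}
    (hφ : φ ∈ F) (hc : φ.Closed) : φ.toFormula ∈ SententialStandpoint F := by
  refine ⟨φ.sentential_toFormula, hc, fun x ψ h => ?_⟩
  rw [φ.ssnf_toFormula] at h
  obtain ⟨χ, hχ⟩ := φ.exists_of_mem_sub _ h
  cases χ <;> cases hχ
  exact ⟨_, hF φ hφ hc _ _ h, rfl⟩

/-! ## Programs compute partial recursive functions -/

/-- Programs are interpreted on Gödel numbers: `nil` has number 0 and a pair has the successor of a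
pairing code. Agreement on halting runs is enough. -/
theorem exists_partrec (p : Prog) :
    ∃ f : ℕ →. ℕ, Partrec f ∧ ∀ x y t, Run p x y t → y.toNat ∈ f x.toNat := by
  have hfst : Primrec fun n : ℕ => bif decide (n = 0) then 0 else (n - 1).unpair.1 :=
    Primrec.cond (Primrec.eq.comp .id (.const 0)).decide (.const 0)
      (Primrec.fst.comp (Primrec.unpair.comp Primrec.pred))
  have hsnd : Primrec fun n : ℕ => bif decide (n = 0) then 0 else (n - 1).unpair.2 :=
    Primrec.cond (Primrec.eq.comp .id (.const 0)).decide (.const 0)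
      (Primrec.snd.comp (Primrec.unpair.comp Primrec.pred))
  have hz : Computable fun p : ℕ × ℕ => decide (p.2 = 0) :=
    (Primrec.eq.comp Primrec.snd (Primrec.const 0)).decide.to_comp
  induction p with
  | id =>
    refine ⟨fun n => Part.some n, Computable.id, fun x y t h => ?_⟩
    cases h; simp
  | nil =>
    refine ⟨fun n => Part.some 0, Computable.const 0, fun x y t h => ?_⟩
    cases h; simp [Data.toNat]
  | fst =>
    refine ⟨_, hfst.to_comp, fun x y t h => ?_⟩
    cases h
    cases x <;> simp [Data.toNat, Data.fst]
  | snd =>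
    refine ⟨_, hsnd.to_comp, fun x y t h => ?_⟩
    cases h
    cases x <;> simp [Data.toNat, Data.snd]
  | pair p q ihp ihq =>
    obtain ⟨f, hf, hf'⟩ := ihp
    obtain ⟨g, hg, hg'⟩ := ihq
    refine ⟨fun n => (f n).bind fun a => (g n).map fun b => Nat.pair a b + 1,
      Partrec.bind hf (Partrec.map (hg.comp Computable.fst) ?_), fun x y t h => ?_⟩
    · exact (Primrec.succ.comp (Primrec₂.natPair.comp (Primrec.snd.comp Primrec.fst)
        Primrec.snd)).to_comp
    · cases h with
      | pair h1 h2 =>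
        exact Part.mem_bind (hf' _ _ _ h1) (Part.mem_map _ (hg' _ _ _ h2))
  | comp p q ihp ihq =>
    obtain ⟨f, hf, hf'⟩ := ihp
    obtain ⟨g, hg, hg'⟩ := ihq
    refine ⟨fun n => (f n).bind g, Partrec.bind hf (hg.comp Computable.snd), fun x y t h => ?_⟩
    cases h with
    | comp h1 h2 => exact Part.mem_bind (hf' _ _ _ h1) (hg' _ _ _ h2)
  | ite c p q ihc ihp ihq =>
    obtain ⟨e, he, he'⟩ := ihc
    obtain ⟨f, hf, hf'⟩ := ihp
    obtain ⟨g, hg, hg'⟩ := ihq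
    refine ⟨fun n => (e n).bind fun a => bif decide (a = 0) then g n else f n,
      Partrec.bind he (Partrec.cond hz (hg.comp Computable.fst) (hf.comp Computable.fst)),
      fun x y t h => ?_⟩
    cases h with
    | ite_then h1 h2 => exact Part.mem_bind (he' _ _ _ h1) (by simpa [Data.toNat] using hf' _ _ _ h2)
    | ite_else h1 h2 => exact Part.mem_bind (he' _ _ _ h1) (by simpa [Data.toNat] using hg' _ _ _ h2)
  | _ =>
    rename_i c p ihc ihp
    obtain ⟨e, he, he'⟩ := ihc
    obtain ⟨f, hf, hf'⟩ := ihp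
    -- One round of the loop in the form required by the fixed-point operator: `Sum.inl` stops with
    -- the current value, `Sum.inr` continues with the new one.
    let step : ℕ →. ℕ ⊕ ℕ := fun n => (e n).bind fun a =>
      bif decide (a = 0) then Part.some (Sum.inl n) else (f n).map Sum.inr
    have hstep : Partrec step := by
      refine Partrec.bind he (Partrec.cond hz ?_ ?_)
      · exact Computable.sumInl.comp Computable.fst
      · exact Partrec.map (hf.comp Computable.fst) (Computable.sumInr.comp Computable.snd)
    refine ⟨_, Partrec.fix hstep, fun x y t h => ?_⟩
    generalize hw : Prog.while c p = w at h
    induction h with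
    | while_done h1 ih =>
      injection hw with h2 h3
      subst h2 h3
      exact PFun.mem_fix_iff.2 (Or.inl (Part.mem_bind (he' _ _ _ h1) (by simp [Data.toNat])))
    | while_step h1 h2 h3 ih1 ih2 ih3 =>
      injection hw with e1 e2
      subst e1 e2
      refine PFun.mem_fix_iff.2 (Or.inr ⟨_, Part.mem_bind (he' _ _ _ h1) ?_, ih3 rfl⟩)
      simpa [Data.toNat] using hf' _ _ _ h2
    | _ => cases hw

/-! ## Reductions between decision problems -/

theorem Problem.Reduces.isDecidable {A B : Problem} (h : A.Reduces B) (hB : B.IsDecidable) :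
    A.IsDecidable := by
  obtain ⟨p, r, hp⟩ := h
  obtain ⟨f, hf, hf'⟩ := hB
  obtain ⟨g, hg, hg'⟩ := exists_partrec p
  refine ⟨fun n => (g n).bind f, Partrec.bind hg (hf.comp Computable.snd), fun i => ?_⟩
  obtain ⟨j, t, h1, -, h2⟩ := hp i
  obtain ⟨b, hb, hb'⟩ := hf' j
  exact ⟨b, Part.mem_bind (hg' _ _ _ h1) hb, hb'.trans h2.symm⟩

/-- A first-order formula and its standpoint version have the same code by definition, so the
identity program is a reduction. -/
theorem satFO_reduces {F : Set FOFormula} (hF : ClosedUnderScopes F) :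
    (satFO F).Reduces (satStandpoint F) :=
  ⟨.id, 2 * .X, fun φ => ⟨⟨φ.1.toFormula, FOFormula.toFormula_mem hF φ.2.1 φ.2.2⟩, _, .id _,
    by simp only [Polynomial.eval_mul, Polynomial.eval_ofNat, Polynomial.eval_X]; omega,
    φ.1.satisfiable_toFormula.symm⟩⟩

theorem satStandpoint_reduces {F : Set FOFormula} (hF : StandpointFriendly F) :
    (satStandpoint F).Reduces (satFO F) := by
  obtain ⟨f, ⟨p, r, hp⟩, hf⟩ := exists_pt_trans_ssnf
  refine ⟨p, r, fun φ => ?_⟩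
  obtain ⟨t, h1, h2⟩ := hp φ.1
  rw [hf φ.1 φ.2.1] at h1
  exact ⟨⟨φ.1.ssnf.trans φ.1.size, hF φ.1 φ.2,
    Formula.closed_trans (Formula.closed_ssnf φ.2.1 φ.2.2.1) _⟩, t, h1, h2,
    (Formula.satisfiable_trans_ssnf_iff φ.2.1).symm⟩

end FOSL

theorem lemma1 (F : Set FOSL.FOFormula)
    (hF : FOSL.ClosedUnderScopes F) (hfriendly : FOSL.StandpointFriendly F) :
    ((FOSL.satStandpoint F).IsDecidable ↔ (FOSL.satFO F).IsDecidable) ∧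
    ((FOSL.satFO F).NPHard →
      (FOSL.satStandpoint F).SameComplexity (FOSL.satFO F)) :=
  ⟨⟨(FOSL.satFO_reduces hF).isDecidable, (FOSL.satStandpoint_reduces hfriendly).isDecidable⟩,
    fun _ => ⟨FOSL.satStandpoint_reduces hfriendly, FOSL.satFO_reduces hF⟩⟩
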